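/- Fix $V\in\mathbb N$, $\beta>0$ and $\mu,\lambda\in\mathbb R$ with either $\lambda>0$, or $\lambda=0$ and $\mu<1$. Let $\mathcal F_V=\ell^2(\mathbb N_0^V)$ be the Fock space of $V$ bosonic modes in the occupation number representation, $\mathcal F_1$ the single-mode Fock space, $n_x$ the (self-adjoint, unbounded) number operator of mode $x$, $\mathcal N=\sum_{x=1}^V n_x$, and $h_x=n_x+\lambda n_x(n_x-1)$. On $\mathcal F_1$ write $n_1$ and $h_1$ for the operators of the single mode. Let $\omega_V=\bigotimes_{x=1}^V\omega_x$ be the product state on $\mathcal B(\mathcal F_V)$ whose factors all have the single-mode Gibbs density matrix $e^{\beta(\mu n_1-h_1)}/\operatorname{Tr}_{\mathcal F_1}e^{\beta(\mu n_1-h_1)}$. For a normal state $\phi_V$ on $\mathcal B(\mathcal F_V)$ with density matrix $\rho_{\phi_V}$ let $$S(\phi_V\,\|\,\omega_V)=-\langle\Phi_V,\ln\Delta_{\Omega_V,\Phi_V}\,\Phi_V\rangle=\operatorname{Tr}\big[\rho_{\phi_V}(\ln\rho_{\phi_V}-\ln\rho_{\omega_V})\big]\in[0,\infty]$$ be the Araki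 relative entropy. Here $\Delta_{\Omega_V,\Phi_V}=\pi(\rho_{\omega_V})\pi'(\rho_{\phi_V})^{-1}$ is the relative modular operator on the Hilbert-Schmidt operators on $\mathcal F_V$ ($\pi$, $\pi'$ denoting left and right multiplication, and the inverse being taken on the support of $\rho_{\phi_V}$), and $\Phi_V=\rho_{\phi_V}^{1/2}$, $\Omega_V=\rho_{\omega_V}^{1/2}$. The matrix element is defined as $-\int\ln t\,\langle\Phi_V,E(dt)\Phi_V\rangle$ with the spectral measure $E$ of $\Delta_{\Omega_V,\Phi_V}$; the part of the integral over $t>1$ always converges, and the part over $t<1$ may be infinite. Then, for every normal state $\phi_V$ on $\mathcal B(\mathcal F_V)$, $$S(\phi_V\,\|\,\omega_V)=\sup_{A=A^*\in\mathcal B(\mathcal F_V)}\Big\{\beta\,\phi_V(A)-\ln\operatorname{Tr}_{\mathcal F_V}e^{\beta(\mu\mathcal N-\sum_{x=1}^V h_x+A)}\Big\}+V\ln\operatorname{Tr}_{\mathcal F_1}e^{\beta(\mu n_1-h_1)},$$ as an identity in $[0,\infty]$ (both sides may be $+\infty$). -/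

import Mathlib

open scoped ENNReal InnerProductSpace

noncomputable section

namespace BoseEntropy

/-- The Fock space of `V` bosonic modes in the occupation number representation: square summable
functions of the occupation numbers `k : Fin V → ℕ`. The single-mode space is `Fock 1`. -/
abbrev Fock (V : ℕ) : Type := lp (fun _ : Fin V → ℕ => ℂ) 2

/-- The bounded operators on the Fock space. -/
abbrev Op (V : ℕ) : Type := Fock V →L[ℂ] Fock V

/-- The occupation number basis vector `|k⟩`. -/
def ket {V : ℕ} (k : Fin V → ℕ) : Fock V := lp.single 2 k (1 : ℂ)

/-! ### Unbounded operators -/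

/-- The self-adjoint operator that is diagonal in the occupation number basis with (real)
eigenvalues `f k`, on its maximal domain `{ψ | f ψ ∈ ℓ²}`. -/
def diagOp {V : ℕ} (f : (Fin V → ℕ) → ℝ) : Fock V →ₗ.[ℂ] Fock V where
  domain :=
    { carrier := {ψ | Memℓp (fun k => (f k : ℂ) * ψ k) 2}
      zero_mem' := by
        have h : (fun k : Fin V → ℕ => (f k : ℂ) * (0 : Fock V) k) = 0 := by
          funext k
          simp
        change Memℓp _ 2
        rw [h]
        exact zero_memℓp
      add_mem' := by
        intro ψ χ hψ hχ
        have h : (fun k : Fin V → ℕ => (f k : ℂ) * (ψ + χ) k)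
            = (fun k => (f k : ℂ) * ψ k) + fun k => (f k : ℂ) * χ k := by
          funext k
          exact mul_add _ _ _
        change Memℓp _ 2
        rw [h]
        exact Memℓp.add hψ hχ
      smul_mem' := by
        intro c ψ hψ
        have h : (fun k : Fin V → ℕ => (f k : ℂ) * (c • ψ) k)
            = c • fun k => (f k : ℂ) * ψ k := by
          funext k
          simp [mul_left_comm]
        change Memℓp _ 2
        rw [h]
        exact Memℓp.const_smul hψ c }
  toFun :=
    { toFun := fun ψ => ⟨fun k => (f k : ℂ) * (ψ : Fock V) k, ψ.2⟩
      map_add' := by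
        intro ψ χ
        ext k
        exact mul_add _ _ _
      map_smul' := by
        intro c ψ
        ext k
        simp [mul_left_comm] }

/-- The number operator `n_x` of the mode `x`: `n_x |k⟩ = k_x |k⟩`. -/
def numberOp {V : ℕ} (x : Fin V) : Fock V →ₗ.[ℂ] Fock V :=
  diagOp fun k => (k x : ℝ)

/-- The on-site Hamiltonian `h_x = n_x + lam n_x (n_x - 1)`, a polynomial in `n_x`. -/
def siteHamiltonian {V : ℕ} (lam : ℝ) (x : Fin V) : Fock V →ₗ.[ℂ] Fock V :=
  diagOp fun k => (k x : ℝ) + lam * (k x : ℝ) * ((k x : ℝ) - 1)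

/-- The unbounded operator `β (μ N - ∑ₓ hₓ + A)` with `N = ∑ₓ nₓ`, for a bounded operator `A`. -/
def gibbsExponent {V : ℕ} (β μ lam : ℝ) (A : Op V) : Fock V →ₗ.[ℂ] Fock V :=
  β • ((A : Fock V →ₗ[ℂ] Fock V) +ᵥ
    (μ • (∑ x : Fin V, numberOp x) - ∑ x : Fin V, siteHamiltonian lam x))

/-- `R = (m - K)⁻¹` is a bounded operator on the whole space: `R y = x` if and only if `x` lies in
the domain of `K` and `m x - K x = y`. -/
def IsResolvent {H : Type*} [NormedAddCommGroup H] [InnerProductSpace ℂ H]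
    (K : H →ₗ.[ℂ] H) (m : ℝ) (R : H →L[ℂ] H) : Prop :=
  ∀ x y : H, R y = x ↔ ∃ h : x ∈ K.domain, (m : ℂ) • x - K ⟨x, h⟩ = y

open Classical in
/-- The exponential `e^K` of a self-adjoint operator `K` that is bounded above. For such a `K` and
a real `m` above its spectrum, `R = (m - K)⁻¹` is bounded and positive, `K = m - R⁻¹`, and hence
`e^K = f(R)` by the functional calculus, with the continuous function `f(r) = e^{m - 1/r}` for
`r > 0`, `f(r) = 0` for `r ≤ 0`. (The kernel of `R` is trivial, and `f(R)` does not depend on the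
choice of `m`. If there is no such `m` then the value is the junk value `0`.) -/
def opExp {H : Type*} [NormedAddCommGroup H] [InnerProductSpace ℂ H] [CompleteSpace H]
    (K : H →ₗ.[ℂ] H) : H →L[ℂ] H :=
  if h : ∃ mR : ℝ × (H →L[ℂ] H), IsResolvent K mR.1 mR.2 ∧ mR.2.IsPositive then
    cfc (fun r : ℝ => if r ≤ 0 then 0 else Real.exp (h.choose.1 - r⁻¹)) h.choose.2
  else 0

/-! ### Traces and normal states -/

/-- The trace, in `[0, ∞]`, of a positive operator. -/
def opTrace {V : ℕ} (T : Op V) : ℝ≥0∞ :=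
  ∑' k : Fin V → ℕ, ENNReal.ofReal (⟪ket k, T (ket k)⟫_ℂ).re

/-- `φ` is the normal state with density matrix `ρ`: `ρ` is positive, `Tr ρ = 1`, and
`φ A = Tr (ρ A)` for every bounded operator `A`. -/
def IsDensityMatrixOf {V : ℕ} (ρ : Op V) (φ : Op V →ₗ[ℂ] ℂ) : Prop :=
  ρ.IsPositive ∧ opTrace ρ = 1 ∧
    ∀ A : Op V, HasSum (fun k : Fin V → ℕ => ⟪ket k, ρ (A (ket k))⟫_ℂ) (φ A)

/-- The density matrix `e^{β(μ n - h)} / Tr e^{β(μ n - h)}` of the single-mode Gibbs state, where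
`h = n + lam n (n - 1)`. -/
def siteDensity (β μ lam : ℝ) : Op 1 :=
  (opTrace (opExp (gibbsExponent (V := 1) β μ lam 0))).toReal⁻¹ •
    opExp (gibbsExponent (V := 1) β μ lam 0)

/-- `S = T ⊗ ⋯ ⊗ T` (`V` factors), through the matrix elements in the occupation number basis. -/
def IsTensorPower {V : ℕ} (T : Op 1) (S : Op V) : Prop :=
  ∀ k l : Fin V → ℕ,
    ⟪ket k, S (ket l)⟫_ℂ = ∏ x : Fin V, ⟪ket (fun _ : Fin 1 => k x), T (ket fun _ => l x)⟫_ℂ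

open Classical in
/-- The density matrix of the product reference state `ω_V = ⨂ₓ ωₓ`. -/
def refDensity (V : ℕ) (β μ lam : ℝ) : Op V :=
  if h : ∃ S : Op V, IsTensorPower (siteDensity β μ lam) S then h.choose else 0

/-! ### Relative entropy -/

/-- The orthogonal projection onto the eigenspace `{ψ | T ψ = t ψ}`. -/
def eigProj {H : Type*} [NormedAddCommGroup H] [InnerProductSpace ℂ H] [CompleteSpace H]
    (T : H →L[ℂ] H) (t : ℝ) : H →L[ℂ] H :=
  (T - (t : ℂ) • (1 : H →L[ℂ] H)).ker.starProjection

/-- The squared Hilbert-Schmidt norm `Tr (T* T)`, in `[0, ∞]`. -/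
def hsNormSq {V : ℕ} (T : Op V) : ℝ≥0∞ :=
  ∑' k : Fin V → ℕ, ‖T (ket k)‖ₑ ^ 2

/-- The spectral measure `⟨Φ, E(·) Φ⟩` of the relative modular operator
`Δ = π(σ) π'(ρ)⁻¹` in the vector `Φ = ρ^{1/2}` of the standard (Hilbert-Schmidt) representation,
for density matrices `ρ`, `σ`. These have discrete spectrum; with their spectral projections
`P_p` (of `ρ`) and `Q_q` (of `σ`), the operator `Δ` acts as `q / p` on the Hilbert-Schmidt operators
of the form `Q_q X P_p`, `p > 0`, so that the measure is the sum over `p > 0` and `q` of the point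
masses `‖Q_q ρ^{1/2} P_p‖² = p ‖Q_q P_p‖²` (in Hilbert-Schmidt norm) at `q / p`. -/
def modularSpectralMeasure {V : ℕ} (ρ σ : Op V) : MeasureTheory.Measure ℝ :=
  MeasureTheory.Measure.sum fun pq : Set.Ioi (0 : ℝ) × ℝ =>
    (ENNReal.ofReal pq.1 * hsNormSq (eigProj σ pq.2 * eigProj ρ pq.1)) •
      MeasureTheory.Measure.dirac (pq.2 / pq.1)

/-- The Araki relative entropy `S(ρ ‖ σ) = - ⟨Φ, ln Δ Φ⟩ = - ∫ ln t ⟨Φ, E(dt) Φ⟩ ∈ [0, ∞]` of the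
normal states with density matrices `ρ` and `σ`, i.e. `Tr (ρ (ln ρ - ln σ))`: the integral of the
positive part of `- ln t` (which is `∞` at `t = 0`) minus the always convergent integral of its
negative part. -/
def relativeEntropy {V : ℕ} (ρ σ : Op V) : EReal :=
  ((∫⁻ t, (-ENNReal.log (ENNReal.ofReal t)).toENNReal ∂modularSpectralMeasure ρ σ : ℝ≥0∞) : EReal)
    - ((∫⁻ t, (ENNReal.log (ENNReal.ofReal t)).toENNReal ∂modularSpectralMeasure ρ σ : ℝ≥0∞) :
      EReal)

end BoseEntropy

end

open scoped ENNReal InnerProductSpace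

noncomputable section

/-! The density matrix `ρ` has finite trace, hence an eigenbasis `v i` with eigenvalues `p i`, while
the reference state is diagonal in the kets with weights `q k = e^{-E k} / Z ^ V`, where `E` is
`energy` and `Z` is `sitePartition`. In these bases the relative entropy is the double sum of `p i
|⟨v i, k⟩|² (log (p i) - log (q k))`, whose negative part is at most `∑ q k` in total. Both
inequalities are then statements about `K = βA - E`.

Entropy dominates (`gibbs_variational_le`): with `T = Tr e^K`, the tangent line inequality `e^c (1 -
c + K) ≤ e^K` is evaluated in each `v i` at `c = log (p i T)`, divided by `T` and summed over `i`.
The right side sums to `1`. Since `K` is unbounded, the inequality is proved through the resolvent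
and extended to vectors of finite energy.

Supremum dominates (`exists_le_variationalValue`): `ρ` is compressed to the span of finitely many
kets `k ∈ F`, with eigenvalues `r j`. A finite rank `A` makes `e^K` equal to the compression plus
`δ` on that span and to `e^{-E}` off it. Klein's inequality (`klein_compression_le`) compares the
compressed entropy with that of `ρ`, and `log t ≤ t - 1` for the trace cancels its slack. Letting `δ
→ 0` and then `F` grow gives the bound, also when the entropy is infinite. -/

namespace BoseEntropy

/-! ### Exponentials of unbounded operators through the resolvent. -/

section FunctionalCalculus

variable {H : Type*} [NormedAddCommGroup H] [InnerProductSpace ℂ H] [CompleteSpace H]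

omit [CompleteSpace H] in
lemma mem_spectrum_of_apply_eq_smul {a : H →L[ℂ] H} {x : H} {t : ℝ} (hx : x ≠ 0)
    (h : a x = (t : ℂ) • x) : t ∈ spectrum ℝ a := by
  intro hu
  have h0 : (algebraMap ℝ (H →L[ℂ] H) t - a) x = 0 := by
    rw [_root_.sub_apply, h, Algebra.algebraMap_eq_smul_one]
    simp
  obtain ⟨u, hu⟩ := hu
  apply hx
  have : (↑u⁻¹ * ↑u : H →L[ℂ] H) x = 0 := by
    rw [mul_apply_eq_comp, hu, h0, map_zero]
  simpa using this

/-- The continuous functional calculus acts on eigenvectors by evaluation. -/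
lemma cfc_apply_eq_smul {a : H →L[ℂ] H} (ha : IsSelfAdjoint a) {f : ℝ → ℝ} (hf : Continuous f)
    {x : H} {t : ℝ} (h : a x = (t : ℂ) • x) : cfc f a x = (f t : ℂ) • x := by
  rcases eq_or_ne x 0 with rfl | hx
  · simp
  have ht := mem_spectrum_of_apply_eq_smul hx h
  have key : ∀ g : C(spectrum ℝ a, ℝ), cfcHom (R := ℝ) ha g x = ((g ⟨t, ht⟩ : ℝ) : ℂ) • x := by
    intro g
    induction g using ContinuousMap.induction_on_of_compact with
    | const r =>
      have : cfcHom (R := ℝ) ha (.const _ r) = algebraMap ℝ _ r :=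
        AlgHomClass.commutes (cfcHom (R := ℝ) ha) r
      rw [this, Algebra.algebraMap_eq_smul_one]
      simp
    | id => rw [cfcHom_id]; simpa using h
    | star_id => rw [map_star, cfcHom_id, ha.star_eq]; simpa using h
    | add f g hf hg => rw [map_add, _root_.add_apply, hf, hg]; simp [add_smul]
    | mul f g hf hg =>
      rw [map_mul, mul_apply_eq_comp, hg, map_smul, hf, smul_smul, ContinuousMap.mul_apply, mul_comm,
        Complex.ofReal_mul]
    | frequently f hf =>
      have hc : IsClosed {g : C(spectrum ℝ a, ℝ) |
          cfcHom (R := ℝ) ha g x = ((g ⟨t, ht⟩ : ℝ) : ℂ) • x} := by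
        apply isClosed_eq
        · exact (ContinuousLinearMap.apply ℂ H x).continuous.comp (cfcHom_continuous ha)
        · exact (Complex.continuous_ofReal.comp (continuous_eval_const _)).smul
            continuous_const
      exact hc.closure_subset (mem_closure_iff_frequently.mpr hf)
  rw [cfc_apply f a ha hf.continuousOn, key]
  rfl

/-- The function `r ↦ e^{m - 1/r}` used to define `opExp` through the resolvent. -/
def expResolvent (m : ℝ) (r : ℝ) : ℝ := if r ≤ 0 then 0 else Real.exp (m - r⁻¹)

lemma expResolvent_nonneg (m r : ℝ) : 0 ≤ expResolvent m r := by
  unfold expResolvent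
  split_ifs
  · exact le_rfl
  · positivity

/-- Continuity at `0` is the point: the resolvent of an unbounded `K` has `0` in its spectrum. -/
lemma continuous_expResolvent (m : ℝ) : Continuous (expResolvent m) := by
  rw [continuous_iff_continuousAt]
  intro r
  rcases lt_trichotomy r 0 with h | rfl | h
  · have : expResolvent m =ᶠ[nhds r] fun _ => 0 := by
      filter_upwards [gt_mem_nhds h] with s hs
      simp [expResolvent, hs.le]
    exact continuousAt_const.congr this.symm
  · have h0 : expResolvent m 0 = 0 := by simp [expResolvent]
    suffices h : Filter.Tendsto (expResolvent m) (nhdsWithin 0 (Set.Iic 0) ⊔ nhdsWithin 0 (Set.Ioi 0))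
        (nhds 0) by
      rw [nhdsLE_sup_nhdsGT] at h
      rwa [ContinuousAt, h0]
    rw [Filter.tendsto_sup]
    constructor
    · refine tendsto_const_nhds.congr' ?_
      filter_upwards [self_mem_nhdsWithin] with s hs
      exact (if_pos hs).symm
    · have : Filter.Tendsto (fun s : ℝ => Real.exp (m - s⁻¹)) (nhdsWithin 0 (Set.Ioi 0))
          (nhds 0) := by
        refine Real.tendsto_exp_atBot.comp ?_
        exact Filter.tendsto_atBot_add_const_left _ m
          (Filter.tendsto_neg_atTop_atBot.comp tendsto_inv_nhdsGT_zero)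
      refine this.congr' ?_
      filter_upwards [self_mem_nhdsWithin] with s hs
      exact (if_neg (not_le.mpr hs)).symm
  · have : expResolvent m =ᶠ[nhds r] fun s => Real.exp (m - s⁻¹) := by
      filter_upwards [lt_mem_nhds h] with s hs
      simp [expResolvent, hs]
    refine ContinuousAt.congr ?_ this.symm
    have := h.ne'
    fun_prop (disch := assumption)

/-- `K` has a positive bounded resolvent at some real point. -/
def HasPositiveResolvent (K : H →ₗ.[ℂ] H) : Prop :=
  ∃ mR : ℝ × (H →L[ℂ] H), IsResolvent K mR.1 mR.2 ∧ mR.2.IsPositive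

/-- Later arguments work for whatever `m` and `R` the choice returns, so independence of the choice
is never needed. -/
lemma opExp_eq_cfc {K : H →ₗ.[ℂ] H} (hK : HasPositiveResolvent K) :
    ∃ (m : ℝ) (R : H →L[ℂ] H), IsResolvent K m R ∧ R.IsPositive ∧
      opExp K = cfc (expResolvent m) R := by
  refine ⟨_, _, hK.choose_spec.1, hK.choose_spec.2, ?_⟩
  exact dif_pos hK

lemma opExp_isPositive {K : H →ₗ.[ℂ] H} : (opExp K).IsPositive := by
  by_cases hK : HasPositiveResolvent K
  · obtain ⟨m, R, -, -, h⟩ := opExp_eq_cfc hK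
    rw [h, ← ContinuousLinearMap.nonneg_iff_isPositive]
    exact cfc_nonneg fun r _ => expResolvent_nonneg m r
  · have : opExp K = 0 := dif_neg hK
    rw [this]
    exact ContinuousLinearMap.isPositive_zero

/-- An eigenvector of `K` is an eigenvector of `R` with eigenvalue `(m - κ)⁻¹`. Positivity of `R`
forces `κ < m`, so the exponential branch of `expResolvent` applies. -/
lemma opExp_apply_eq_smul {K : H →ₗ.[ℂ] H} (hK : HasPositiveResolvent K) {x : H}
    (hx : x ∈ K.domain) {κ : ℝ} (h : K ⟨x, hx⟩ = (κ : ℂ) • x) :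
    opExp K x = (Real.exp κ : ℂ) • x := by
  rcases eq_or_ne x 0 with rfl | hx0
  · simp
  obtain ⟨m, R, hR, hpos, he⟩ := opExp_eq_cfc hK
  have h1 : R (((m : ℂ) - κ) • x) = x := by
    rw [hR]
    exact ⟨hx, by rw [h, sub_smul]⟩
  have hne : (m : ℂ) - κ ≠ 0 := by
    intro h0
    rw [h0, zero_smul, map_zero] at h1
    exact hx0 h1.symm
  have h2 : R x = (((m - κ)⁻¹ : ℝ) : ℂ) • x := by
    rw [map_smul] at h1
    conv_rhs => rw [← h1, smul_smul]
    push_cast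
    rw [inv_mul_cancel₀ hne, one_smul]
  have h3 : 0 < (m - κ)⁻¹ := by
    have := hpos.re_inner_nonneg_right x
    rw [h2, inner_smul_right, inner_self_eq_norm_sq_to_K] at this
    have hx' : 0 < ‖x‖ ^ 2 := by positivity
    have h4 : 0 ≤ (m - κ)⁻¹ * ‖x‖ ^ 2 := by
      have e : (((m - κ)⁻¹ : ℝ) : ℂ) * ((‖x‖ : ℝ) : ℂ) ^ 2 = (((m - κ)⁻¹ * ‖x‖ ^ 2 : ℝ) : ℂ) := by
        push_cast; rfl
      rw [show ((RCLike.ofReal ‖x‖ : ℂ)) = ((‖x‖ : ℝ) : ℂ) from rfl, e] at this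
      exact this
    refine lt_of_le_of_ne (nonneg_of_mul_nonneg_left h4 hx') ?_
    intro h5
    apply hne
    have : m - κ = 0 := by simpa using h5.symm
    exact_mod_cast this
  rw [he, cfc_apply_eq_smul hpos.isSelfAdjoint (continuous_expResolvent m) h2]
  congr 2
  simp [expResolvent, not_le.mpr h3] 

/-- The operator form of the tangent line inequality `e^c (1 - c + t) ≤ e^t`. -/
lemma tangent_le_opExp {K : H →ₗ.[ℂ] H} (hK : HasPositiveResolvent K) (x : K.domain) (c : ℝ) :
    Real.exp c * ((1 - c) * ‖(x : H)‖ ^ 2 + (⟪(x : H), K x⟫_ℂ).re)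
      ≤ (⟪(x : H), opExp K x⟫_ℂ).re := by
  obtain ⟨m, R, hR, hpos, he⟩ := opExp_eq_cfc hK
  have hsa := hpos.isSelfAdjoint
  have hcont := continuous_expResolvent m
  set w : H := (m : ℂ) • (x : H) - K x with hw
  have hRw : R w = x := (hR _ _).mpr ⟨x.2, rfl⟩
  -- Since `x = R w`, forms in `x` are forms in `w` sandwiched by `R`. Multiplying `e^c (1 - c + t)
  -- ≤ e^t` at `t = m - 1/r` by `r²` removes the pole, and at `r = 0` both sides vanish.
  have hle : cfc (fun r : ℝ => Real.exp c * ((1 + m - c) * (r * r) - r)) R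
      ≤ cfc (fun r : ℝ => r * (expResolvent m r * r)) R := by
    apply cfc_mono
    · intro r hr
      have hr0 : 0 ≤ r := spectrum_nonneg_of_nonneg
        ((ContinuousLinearMap.nonneg_iff_isPositive R).mpr hpos) hr
      rcases hr0.eq_or_lt with rfl | hr1
      · simp
      · have hexp : expResolvent m r = Real.exp c * Real.exp (m - r⁻¹ - c) := by
          rw [← Real.exp_add]
          simp [expResolvent, not_le.mpr hr1]
        have h1 := Real.add_one_le_exp (m - r⁻¹ - c)
        rw [hexp]
        have h2 : Real.exp c * ((1 + m - c) * (r * r) - r)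
            = Real.exp c * (r * r * (m - r⁻¹ - c + 1)) := by
          field_simp
          ring
        rw [h2]
        calc Real.exp c * (r * r * (m - r⁻¹ - c + 1))
            ≤ Real.exp c * (r * r * Real.exp (m - r⁻¹ - c)) := by gcongr
          _ = _ := by ring
    · exact Continuous.continuousOn (by fun_prop)
    · exact Continuous.continuousOn (by fun_prop)
  have e1 : cfc (fun r : ℝ => r * (expResolvent m r * r)) R = R * (opExp K * R) := by
    rw [cfc_mul (fun r => r) (fun r => expResolvent m r * r) R,
      cfc_mul (expResolvent m) (fun r => r) R, cfc_id' ℝ R, he]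
  have e2 : cfc (fun r : ℝ => Real.exp c * ((1 + m - c) * (r * r) - r)) R
      = Real.exp c • ((1 + m - c) • (R * R) - R) := by
    rw [cfc_const_mul _ _ R, cfc_sub (fun r : ℝ => (1 + m - c) * (r * r)) (fun r => r) R,
      cfc_const_mul _ _ R, cfc_mul (fun r => r) (fun r => r) R, cfc_id' ℝ R]
  rw [e1, e2, ContinuousLinearMap.le_def] at hle
  have h := hle.re_inner_nonneg_right w
  have hsymm : ∀ y, ⟪w, R y⟫_ℂ = ⟪(x : H), y⟫_ℂ := by
    intro y
    rw [← hpos.inner_left_eq_inner_right, hRw]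
  have hself : (⟪(x : H), x⟫_ℂ).re = ‖(x : H)‖ ^ 2 := inner_self_eq_norm_sq (𝕜 := ℂ) (x : H)
  have hxw : (⟪w, (x : H)⟫_ℂ).re = m * ‖(x : H)‖ ^ 2 - (⟪(x : H), K x⟫_ℂ).re := by
    rw [← RCLike.re_to_complex, inner_re_symm, RCLike.re_to_complex, hw, inner_sub_right,
      inner_smul_right, Complex.sub_re, Complex.re_ofReal_mul, hself]
  simp only [_root_.sub_apply, mul_apply_eq_comp,
    _root_.smul_apply, inner_sub_right, hRw, inner_smul_right_eq_smul,
    hsymm] at h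
  simp only [RCLike.re_to_complex, Complex.sub_re, Complex.smul_re, hself, hxw,
    smul_eq_mul] at h
  linarith

end FunctionalCalculus

/-! ### The occupation number basis and bounded diagonal operators. -/

section OccupationBasis

variable {V : ℕ}

/-- The occupation number basis as a Hilbert basis. -/
def ketBasis (V : ℕ) : HilbertBasis (Fin V → ℕ) ℂ (Fock V) :=
  HilbertBasis.ofRepr (LinearIsometryEquiv.refl ℂ _)

@[simp]
lemma ketBasis_apply (k : Fin V → ℕ) : ketBasis V k = ket k :=
  ((ketBasis V).repr_symm_single k).symm

lemma inner_ket_left (k : Fin V → ℕ) (ψ : Fock V) : ⟪ket k, ψ⟫_ℂ = ψ k := by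
  rw [ket, lp.inner_single_left]
  simp

lemma ket_apply (k l : Fin V → ℕ) : (ket k : Fock V) l = if l = k then 1 else 0 := by
  rw [ket, lp.coeFn_single, Pi.single_apply]

lemma ket_apply_of_ne {k l : Fin V → ℕ} (h : l ≠ k) : (ket k : Fock V) l = 0 := by
  rw [ket_apply, if_neg h]

lemma norm_ket (k : Fin V → ℕ) : ‖(ket k : Fock V)‖ = 1 := by
  rw [← ketBasis_apply]
  exact (ketBasis V).orthonormal.1 k

lemma ext_inner_ket {S T : Op V} (h : ∀ k l : Fin V → ℕ, ⟪ket k, S (ket l)⟫_ℂ = ⟪ket k, T (ket l)⟫_ℂ) :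
    S = T := by
  have hb := (ketBasis V).dense_span
  refine ContinuousLinearMap.ext_on
    (s := Set.range (ketBasis V)) ((Submodule.dense_iff_topologicalClosure_eq_top).mpr hb) ?_
  rintro _ ⟨l, rfl⟩
  ext k
  rw [← inner_ket_left, ← inner_ket_left, ketBasis_apply, h]

/-- The bounded operator that is diagonal in the occupation number basis. -/
def boundedDiag (f : (Fin V → ℕ) → ℝ) (C : ℝ) (hf : ∀ k, |f k| ≤ C) : Op V :=
  LinearMap.mkContinuous
    { toFun := fun ψ => ⟨fun k => (f k : ℂ) * ψ k, by
        refine Memℓp.mono' ((lp.memℓp ψ).const_smul (C : ℂ)) fun k => ?_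
        simp only [norm_mul, Complex.norm_real, Real.norm_eq_abs, Pi.smul_apply, norm_smul]
        exact mul_le_mul_of_nonneg_right ((hf k).trans (le_abs_self C)) (norm_nonneg _)⟩
      map_add' := fun ψ χ => by ext k; exact mul_add _ _ _
      map_smul' := fun c ψ => by ext k; simp [mul_left_comm] } |C| fun ψ => by
    have : ‖((C : ℂ) • ψ : Fock V)‖ = |C| * ‖ψ‖ := by
      rw [norm_smul, Complex.norm_real, Real.norm_eq_abs]
    rw [← this]
    refine lp.norm_mono two_ne_zero fun k => ?_
    change ‖(f k : ℂ) * ψ k‖ ≤ ‖(C : ℂ) * ψ k‖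
    simp only [norm_mul, Complex.norm_real, Real.norm_eq_abs]
    exact mul_le_mul_of_nonneg_right ((hf k).trans (le_abs_self C)) (norm_nonneg _)

lemma boundedDiag_apply (f : (Fin V → ℕ) → ℝ) (C : ℝ) (hf : ∀ k, |f k| ≤ C) (ψ : Fock V)
    (k : Fin V → ℕ) : boundedDiag f C hf ψ k = f k * ψ k := rfl

lemma boundedDiag_ket (f : (Fin V → ℕ) → ℝ) (C : ℝ) (hf : ∀ k, |f k| ≤ C) (k : Fin V → ℕ) :
    boundedDiag f C hf (ket k) = (f k : ℂ) • ket k := by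
  ext l
  rw [boundedDiag_apply, lp.coeFn_smul, Pi.smul_apply, smul_eq_mul]
  rcases eq_or_ne l k with rfl | h
  · rfl
  · rw [ket_apply_of_ne h, mul_zero, mul_zero]

lemma norm_boundedDiag_le (f : (Fin V → ℕ) → ℝ) {C : ℝ} (hC : 0 ≤ C) (hf : ∀ k, |f k| ≤ C) :
    ‖boundedDiag f C hf‖ ≤ C := by
  exact (LinearMap.mkContinuous_norm_le _ (abs_nonneg C) _).trans (abs_of_nonneg hC).le

end OccupationBasis

/-! ### Energy bounds, the domain and resolvent of the Gibbs exponent, and the partition function.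
-/

section Energy

variable {V : ℕ}

/-- The eigenvalues of `β ∑ₓ (hₓ - μ nₓ)`. -/
def energy (β μ lam : ℝ) (k : Fin V → ℕ) : ℝ :=
  β * ∑ x, ((k x : ℝ) + lam * (k x : ℝ) * ((k x : ℝ) - 1) - μ * (k x : ℝ))

lemma sum_diagOp {ι : Type*} (s : Finset ι) (g : ι → (Fin V → ℕ) → ℝ) :
    (∀ ψ : Fock V, ψ ∈ (∑ i ∈ s, diagOp (g i)).domain ↔
      ∀ i ∈ s, Memℓp (fun k => (g i k : ℂ) * ψ k) 2) ∧
    ∀ (ψ : (∑ i ∈ s, diagOp (g i)).domain) (k : Fin V → ℕ),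
      ((∑ i ∈ s, diagOp (g i)) ψ) k = ((∑ i ∈ s, g i k : ℝ) : ℂ) * (ψ : Fock V) k := by
  classical
  induction s using Finset.induction_on with
  | empty =>
    simp only [Finset.sum_empty]
    exact ⟨fun ψ => by simp, fun ψ k => by simp⟩
  | insert i s hi ih =>
    rw [Finset.sum_insert hi]
    refine ⟨fun ψ => ?_, fun ψ k => ?_⟩
    · rw [LinearPMap.add_domain, Submodule.mem_inf, ih.1, Finset.forall_mem_insert]
      rfl
    · have h1 := ih.2 ⟨ψ, ψ.2.2⟩ k
      rw [Finset.sum_insert hi, LinearPMap.add_apply]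
      change (diagOp (g i) ⟨ψ, ψ.2.1⟩) k + _ = _
      rw [h1]
      push_cast
      rw [add_mul]
      rfl

/-- The repulsion or, without it, the gap `1 - μ` controls the chemical potential. -/
lemma exists_siteEnergy_bound {μ lam : ℝ} (hlam : 0 < lam ∨ (lam = 0 ∧ μ < 1)) :
    ∃ c C : ℝ, 0 < c ∧ 0 ≤ C ∧ ∀ n : ℕ, (n : ℝ) + lam * n * ((n : ℝ) - 1)
      ≤ c * ((n : ℝ) + lam * n * ((n : ℝ) - 1) - μ * n) + C := by
  rcases hlam with h | ⟨rfl, h⟩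
  -- With factor `2` the difference of the two sides is `lam n² + (1 - lam - 2μ) n + C`, and this
  -- `C` completes the square.
  · refine ⟨2, (1 - lam - 2 * μ) ^ 2 / (4 * lam), by norm_num, by positivity, fun n => ?_⟩
    have : 0 ≤ lam * ((n : ℝ) + (1 - lam - 2 * μ) / (2 * lam)) ^ 2 := by positivity
    have e : lam * ((n : ℝ) + (1 - lam - 2 * μ) / (2 * lam)) ^ 2
      = lam * n ^ 2 + (1 - lam - 2 * μ) * n + (1 - lam - 2 * μ) ^ 2 / (4 * lam) := by
      field_simp
      ring
    linarith
  · refine ⟨(1 - μ)⁻¹, 0, by simpa using h, le_rfl, fun n => ?_⟩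
    have : (1 - μ) ≠ 0 := by linarith
    apply le_of_eq
    field_simp
    ring

lemma le_siteHamiltonian {lam : ℝ} (hlam : 0 ≤ lam) (n : ℕ) :
    (n : ℝ) ≤ (n : ℝ) + lam * n * ((n : ℝ) - 1) := by
  rcases n with _ | n
  · simp
  · have : 0 ≤ lam * ((n + 1 : ℕ) : ℝ) * (((n + 1 : ℕ) : ℝ) - 1) := by
      push_cast
      have : (0 : ℝ) ≤ n := n.cast_nonneg
      have : (n : ℝ) + 1 - 1 = n := by ring
      rw [this]
      positivity
    linarith

lemma siteHamiltonian_le_energy {β μ lam : ℝ} (hβ : 0 < β)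
    (hlam : 0 < lam ∨ (lam = 0 ∧ μ < 1)) :
    ∃ c C : ℝ, 0 < c ∧ 0 ≤ C ∧ ∀ k : Fin V → ℕ,
      ∑ x, ((k x : ℝ) + lam * (k x : ℝ) * ((k x : ℝ) - 1)) ≤ c * energy β μ lam k + C := by
  obtain ⟨c, C, hc, hC, h⟩ := exists_siteEnergy_bound hlam
  refine ⟨c / β, V * C, by positivity, by positivity, fun k => ?_⟩
  calc _ ≤ ∑ x, (c * ((k x : ℝ) + lam * k x * ((k x : ℝ) - 1) - μ * k x) + C) :=
        Finset.sum_le_sum fun x _ => h (k x)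
    _ = _ := by
        rw [Finset.sum_add_distrib, ← Finset.mul_sum, energy]
        field_simp
        simp

lemma sum_le_energy {β μ lam : ℝ} (hβ : 0 < β) (hlam : 0 < lam ∨ (lam = 0 ∧ μ < 1)) :
    ∃ c C : ℝ, 0 < c ∧ 0 ≤ C ∧ ∀ k : Fin V → ℕ, ∑ x, (k x : ℝ) ≤ c * energy β μ lam k + C := by
  have hl : 0 ≤ lam := by rcases hlam with h | h <;> linarith
  obtain ⟨c, C, hc, hC, h⟩ := siteHamiltonian_le_energy (V := V) hβ hlam
  exact ⟨c, C, hc, hC, fun k =>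
    (Finset.sum_le_sum fun x _ => le_siteHamiltonian hl (k x)).trans (h k)⟩

lemma exists_le_energy {β μ lam : ℝ} (hβ : 0 < β) (hlam : 0 < lam ∨ (lam = 0 ∧ μ < 1)) :
    ∃ C : ℝ, ∀ k : Fin V → ℕ, -C ≤ energy β μ lam k := by
  obtain ⟨c, C, hc, hC, h⟩ := sum_le_energy (V := V) hβ hlam
  refine ⟨C / c, fun k => ?_⟩
  have h0 : 0 ≤ ∑ x, (k x : ℝ) := by positivity
  rw [neg_le_iff_add_nonneg, ← mul_nonneg_iff_of_pos_left hc]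
  have := h k
  field_simp
  linarith

lemma memℓp_mul_of_abs_le {f g : (Fin V → ℕ) → ℝ} {c C : ℝ} {ψ : Fock V}
    (hfg : ∀ k, |f k| ≤ c * |g k| + C) (hg : Memℓp (fun k => (g k : ℂ) * ψ k) 2) :
    Memℓp (fun k => (f k : ℂ) * ψ k) 2 := by
  have h1 : Memℓp (fun k => |c| * ‖(g k : ℂ) * ψ k‖ + |C| * ‖ψ k‖) 2 :=
    (hg.norm.const_smul (|c|)).add ((lp.memℓp ψ).norm.const_smul (|C|))
  refine h1.mono fun k => ?_
  simp only [norm_mul, Complex.norm_real, Real.norm_eq_abs]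
  have h2 := hfg k
  have h3 : |f k| ≤ |c| * |g k| + |C| := by
    have := mul_le_mul_of_nonneg_right (le_abs_self c) (abs_nonneg (g k))
    have := le_abs_self C
    linarith
  have := mul_le_mul_of_nonneg_right h3 (norm_nonneg (ψ k))
  linarith

/-- The formal domain is the intersection of the domains of all summands. Cancellation between `μ N`
and `∑ hₓ` does not enlarge it, because each `n_x` and `h_x` is bounded by an affine function of the
energy. A resolvent defined everywhere requires this maximal domain. -/
lemma gibbsExponent_domain {β μ lam : ℝ} (hβ : 0 < β) (hlam : 0 < lam ∨ (lam = 0 ∧ μ < 1))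
    (A : Op V) (ψ : Fock V) :
    ψ ∈ (gibbsExponent β μ lam A).domain ↔
      Memℓp (fun k => (energy β μ lam k : ℂ) * ψ k) 2 := by
  have hl : 0 ≤ lam := by rcases hlam with h | h <;> linarith
  have hN := (sum_diagOp (V := V) Finset.univ fun x k => (k x : ℝ)).1 ψ
  have hH := (sum_diagOp (V := V) Finset.univ
    fun x k => (k x : ℝ) + lam * (k x : ℝ) * ((k x : ℝ) - 1)).1 ψ
  have : ψ ∈ (gibbsExponent β μ lam A).domain ↔
      ψ ∈ (∑ x : Fin V, numberOp x).domain ∧ ψ ∈ (∑ x : Fin V, siteHamiltonian lam x).domain :=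
    Iff.rfl
  rw [this]
  refine (and_congr hN hH).trans ⟨fun ⟨h1, h2⟩ => ?_, fun h => ?_⟩
  · have h3 : Memℓp (fun k => ∑ x : Fin V,
        ((β : ℂ) * (((k x : ℝ) + lam * (k x : ℝ) * ((k x : ℝ) - 1) : ℝ) * ψ k)
          + (-(β * μ) : ℂ) * (((k x : ℝ) : ℂ) * ψ k))) 2 :=
      Memℓp.finsetSum Finset.univ fun x hx =>
        ((h2 x hx).const_smul (β : ℂ)).add ((h1 x hx).const_smul (-(β * μ) : ℂ))
    convert h3 using 2 with k
    rw [energy, Finset.mul_sum]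
    push_cast
    rw [Finset.sum_mul]
    refine Finset.sum_congr rfl fun x _ => ?_
    ring
  · obtain ⟨c, C, hc, hC, hb⟩ := siteHamiltonian_le_energy (V := V) hβ hlam
    have key : ∀ (x : Fin V) (k : Fin V → ℕ),
        (k x : ℝ) + lam * (k x : ℝ) * ((k x : ℝ) - 1) ≤ c * |energy β μ lam k| + C := by
      intro x k
      have h1 := Finset.single_le_sum
        (f := fun x => (k x : ℝ) + lam * (k x : ℝ) * ((k x : ℝ) - 1))
        (fun y _ => (Nat.cast_nonneg (k y)).trans (le_siteHamiltonian hl (k y)))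
        (Finset.mem_univ x)
      have h2 := hb k
      have h3 := mul_le_mul_of_nonneg_left (le_abs_self (energy β μ lam k)) hc.le
      linarith
    refine ⟨fun x _ => memℓp_mul_of_abs_le (c := c) (C := C) (fun k => ?_) h,
      fun x _ => memℓp_mul_of_abs_le (c := c) (C := C) (fun k => ?_) h⟩
    · rw [abs_of_nonneg (Nat.cast_nonneg _)]
      exact (le_siteHamiltonian hl (k x)).trans (key x k)
    · rw [abs_of_nonneg ((Nat.cast_nonneg _).trans (le_siteHamiltonian hl (k x)))]
      exact key x k

lemma gibbsExponent_apply_apply {β μ lam : ℝ} (A : Op V)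
    (ψ : (gibbsExponent β μ lam A).domain) (k : Fin V → ℕ) :
    (gibbsExponent β μ lam A ψ) k
      = β * (A (ψ : Fock V)) k - (energy β μ lam k : ℂ) * (ψ : Fock V) k := by
  have hN := (sum_diagOp (V := V) Finset.univ fun x k => (k x : ℝ)).2 ⟨ψ, ψ.2.1⟩ k
  have hH := (sum_diagOp (V := V) Finset.univ
    fun x k => (k x : ℝ) + lam * (k x : ℝ) * ((k x : ℝ) - 1)).2 ⟨ψ, ψ.2.2⟩ k
  have : (gibbsExponent β μ lam A ψ) k = (β : ℂ) * ((A (ψ : Fock V)) k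
      + ((μ : ℂ) * ((∑ x : Fin V, numberOp x) ⟨ψ, ψ.2.1⟩ : Fock V) k
        - ((∑ x : Fin V, siteHamiltonian lam x) ⟨ψ, ψ.2.2⟩ : Fock V) k)) := rfl
  rw [this]
  refine (congrArg₂ (fun a b => (β : ℂ) * ((A (ψ : Fock V)) k + ((μ : ℂ) * a - b))) hN hH).trans ?_
  simp only [energy, Finset.sum_sub_distrib, ← Finset.mul_sum]
  push_cast
  ring

/-- With `D = (m + E)⁻¹` one has `m - K = (1 - βAD)(m + E)`. For `m` so large that `m + E ≥ β‖A‖ +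
1`, the first factor is inverted by a Neumann series. -/
lemma hasPositiveResolvent_gibbsExponent {β μ lam : ℝ} (hβ : 0 < β)
    (hlam : 0 < lam ∨ (lam = 0 ∧ μ < 1)) {A : Op V} (hA : IsSelfAdjoint A) :
    HasPositiveResolvent (gibbsExponent β μ lam A) := by
  obtain ⟨C, hC⟩ := exists_le_energy (V := V) hβ hlam
  set d0 : ℝ := β * ‖A‖ + 1 with hd0
  have hd0pos : 0 < d0 := by positivity
  set m : ℝ := C + d0 with hm
  have hd : ∀ k : Fin V → ℕ, d0 ≤ m + energy β μ lam k := fun k => by linarith [hC k]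
  have hdpos : ∀ k : Fin V → ℕ, 0 < m + energy β μ lam k := fun k => hd0pos.trans_le (hd k)
  have hdne : ∀ k : Fin V → ℕ, (m : ℂ) + energy β μ lam k ≠ 0 := fun k => by
    exact_mod_cast (hdpos k).ne'
  have hinv : ∀ k : Fin V → ℕ, |(m + energy β μ lam k)⁻¹| ≤ d0⁻¹ := fun k => by
    rw [abs_of_pos (inv_pos.mpr (hdpos k))]
    exact inv_anti₀ hd0pos (hd k)
  set D : Op V := boundedDiag _ d0⁻¹ hinv with hD
  have hDk : ∀ (z : Fock V) (k), ((m : ℂ) + energy β μ lam k) * D z k = z k := fun z k => by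
    rw [hD, boundedDiag_apply]
    push_cast
    rw [mul_inv_cancel_left₀ (hdne k)]
  set t : Op V := ((β : ℂ) • A) * D with ht
  have htn : ‖t‖ < 1 := by
    calc ‖t‖ ≤ ‖(β : ℂ) • A‖ * ‖D‖ := norm_mul_le _ _
      _ ≤ (β * ‖A‖) * d0⁻¹ := by
        rw [norm_smul, Complex.norm_real, Real.norm_eq_abs, abs_of_pos hβ]
        gcongr
        exact norm_boundedDiag_le _ (by positivity) hinv
      _ < 1 := by
        rw [← div_eq_mul_inv, div_lt_one hd0pos]
        linarith
  set u := Units.oneSub t htn with hu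
  have huz : ∀ z, (u : Op V) z = z - (β : ℂ) • A (D z) := fun z => rfl
  have huu : ∀ y, (u : Op V) ((↑u⁻¹ : Op V) y) = y := fun y => by
    rw [← mul_apply_eq_comp, Units.mul_inv, one_apply_eq_self]
  have huu' : ∀ y, (↑u⁻¹ : Op V) ((u : Op V) y) = y := fun y => by
    rw [← mul_apply_eq_comp, Units.inv_mul, one_apply_eq_self]
  refine ⟨⟨m, D * ↑u⁻¹⟩, fun x y => ⟨fun h => ?_, fun ⟨hx, h⟩ => ?_⟩, ?_⟩
  · obtain ⟨z, rfl⟩ : ∃ z, y = (u : Op V) z := ⟨_, (huu y).symm⟩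
    rw [mul_apply_eq_comp, huu'] at h
    subst h
    have hx : D z ∈ (gibbsExponent β μ lam A).domain := by
      rw [gibbsExponent_domain hβ hlam]
      convert lp.memℓp (z - (m : ℂ) • D z) using 1
      ext k
      have := hDk z k
      rw [lp.coeFn_sub, Pi.sub_apply, lp.coeFn_smul, Pi.smul_apply, smul_eq_mul, ← this]
      ring
    refine ⟨hx, ?_⟩
    ext k
    have := hDk z k
    rw [huz]
    simp only [lp.coeFn_sub, Pi.sub_apply, lp.coeFn_smul, Pi.smul_apply, smul_eq_mul,
      gibbsExponent_apply_apply]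
    rw [← this]
    ring
  · have hz : D (y + (β : ℂ) • A x) = x := by
      ext k
      have h1 := hDk (y + (β : ℂ) • A x) k
      apply mul_left_cancel₀ (hdne k)
      rw [h1, ← h]
      simp only [lp.coeFn_sub, lp.coeFn_add, Pi.add_apply, Pi.sub_apply, lp.coeFn_smul,
        Pi.smul_apply, smul_eq_mul, gibbsExponent_apply_apply]
      ring
    have hy : y = (u : Op V) (y + (β : ℂ) • A x) := by
      rw [huz, hz, add_sub_cancel_right]
    rw [hy, mul_apply_eq_comp, huu', hz]
  -- For `x = D z` the form of the resolvent is `⟨x, (m + E) x⟩ - β ⟨x, A x⟩ ≥ (d0 - β‖A‖) ‖x‖²`.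
  · rw [ContinuousLinearMap.isPositive_iff_complex]
    intro y
    obtain ⟨z, rfl⟩ : ∃ z, y = (u : Op V) z := ⟨_, (huu y).symm⟩
    simp only [mul_apply_eq_comp]
    rw [huu', huz]
    set x := D z with hx
    have hsum : HasSum (fun k => (((m + energy β μ lam k) * ‖x k‖ ^ 2 : ℝ) : ℂ)) ⟪x, z⟫_ℂ := by
      have e : (fun k => (((m + energy β μ lam k) * ‖x k‖ ^ 2 : ℝ) : ℂ))
          = fun k => ⟪x k, z k⟫_ℂ := funext fun k => ?_
      · rw [e]
        exact lp.hasSum_inner (𝕜 := ℂ) x z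
      rw [← hDk z k, ← hx]
      simp only [RCLike.inner_apply]
      push_cast
      rw [mul_assoc, Complex.mul_conj, Complex.normSq_eq_norm_sq]
      push_cast
      ring
    have hre : HasSum (fun k => (m + energy β μ lam k) * ‖x k‖ ^ 2) (⟪x, z⟫_ℂ).re := by
      exact Complex.hasSum_re hsum
    have him : (⟪x, z⟫_ℂ).im = 0 := by
      have := Complex.hasSum_im hsum
      simp only [Complex.ofReal_im] at this
      exact this.unique hasSum_zero
    have hnorm : HasSum (fun k => ‖x k‖ ^ 2) (‖x‖ ^ 2) := by
      simpa using lp.hasSum_norm (p := 2) (by norm_num) x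
    have h1 : d0 * ‖x‖ ^ 2 ≤ (⟪x, z⟫_ℂ).re :=
      hasSum_le (fun k => mul_le_mul_of_nonneg_right (hd k) (by positivity))
        (hnorm.mul_left d0) hre
    have hAim : (⟪x, A x⟫_ℂ).im = 0 := by
      exact (ContinuousLinearMap.isSelfAdjoint_iff_isSymmetric.mp hA).im_inner_self_apply x
    have hAre : (⟪x, A x⟫_ℂ).re ≤ ‖A‖ * ‖x‖ ^ 2 := by
      calc (⟪x, A x⟫_ℂ).re ≤ ‖x‖ * ‖A x‖ := re_inner_le_norm (𝕜 := ℂ) x (A x)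
        _ ≤ ‖x‖ * (‖A‖ * ‖x‖) := by gcongr; exact A.le_opNorm x
        _ = _ := by ring
    have e : ⟪x, z - (β : ℂ) • A x⟫_ℂ
        = (((⟪x, z⟫_ℂ).re - β * (⟪x, A x⟫_ℂ).re : ℝ) : ℂ) := by
      rw [inner_sub_right, inner_smul_right]
      apply Complex.ext <;> simp [him, hAim]
    rw [e]
    refine ⟨by simp, ?_⟩
    have : β * (⟪x, A x⟫_ℂ).re ≤ β * (‖A‖ * ‖x‖ ^ 2) := by gcongr
    simp only [RCLike.re_to_complex, Complex.ofReal_re]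
    nlinarith [sq_nonneg ‖x‖]

lemma tsum_prod_fin (f : ℕ → ℝ≥0∞) (V : ℕ) :
    ∑' k : Fin V → ℕ, ∏ x, f (k x) = (∑' n, f n) ^ V := by
  induction V with
  | zero => simp [tsum_fintype]
  | succ V ih =>
    rw [← (Fin.consEquiv fun _ : Fin (V + 1) => ℕ).tsum_eq, ENNReal.tsum_prod']
    simp only [Fin.consEquiv, Equiv.coe_fn_mk, Fin.prod_univ_succ, Fin.cons_zero, Fin.cons_succ]
    simp only [ENNReal.tsum_mul_left]
    rw [ih, ENNReal.tsum_mul_right, pow_succ']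

/-- The energy grows at least linearly in the particle number, so a product of geometric series
dominates. -/
lemma summable_exp_neg_energy {β μ lam : ℝ} (hβ : 0 < β) (hlam : 0 < lam ∨ (lam = 0 ∧ μ < 1)) :
    Summable fun k : Fin V → ℕ => Real.exp (-energy β μ lam k) := by
  obtain ⟨c, C, hc, hC, h⟩ := sum_le_energy (V := V) hβ hlam
  have hr1 : Real.exp (-c⁻¹) < 1 := by
    rw [Real.exp_lt_one_iff]
    simpa using hc
  have hs : Summable fun k : Fin V → ℕ => ∏ x, Real.exp (-c⁻¹) ^ k x := by
    have hfin : ∑' k : Fin V → ℕ, ∏ x, ENNReal.ofReal (Real.exp (-c⁻¹)) ^ k x ≠ ∞ := by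
      rw [tsum_prod_fin (fun n => ENNReal.ofReal (Real.exp (-c⁻¹)) ^ n), ENNReal.tsum_geometric]
      refine ENNReal.pow_ne_top (ENNReal.inv_ne_top.mpr ?_)
      rw [Ne, tsub_eq_zero_iff_le, not_le, ← ENNReal.ofReal_one]
      exact (ENNReal.ofReal_lt_ofReal_iff one_pos).mpr hr1
    have := ENNReal.summable_toReal hfin
    refine this.congr fun k => ?_
    rw [ENNReal.toReal_prod]
    simp [ENNReal.toReal_ofReal (Real.exp_pos _).le]
  refine Summable.of_nonneg_of_le (fun k => (Real.exp_pos _).le) (fun k => ?_)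
    (hs.mul_left (Real.exp (C / c)))
  simp only [← Real.exp_nat_mul, ← Real.exp_sum]
  rw [← Real.exp_add, Real.exp_le_exp, ← Finset.sum_mul]
  have := h k
  have h2 : (∑ x, (k x : ℝ)) / c ≤ energy β μ lam k + C / c := by
    rw [div_le_iff₀ hc]
    field_simp
    linarith
  rw [div_eq_mul_inv] at h2
  linarith

end Energy

/-! ### Basis independence of traces, and diagonalization of trace class operators. -/

section TraceInBases

variable {H : Type*} [NormedAddCommGroup H] [InnerProductSpace ℂ H]

/-- Parseval in `ℝ≥0∞`, where double sums can be exchanged freely. -/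
lemma tsum_enorm_inner_sq {ι : Type*} (v : HilbertBasis ι ℂ H) (x : H) :
    ∑' i, ‖⟪v i, x⟫_ℂ‖ₑ ^ 2 = ‖x‖ₑ ^ 2 := by
  have h : HasSum (fun i => ‖⟪v i, x⟫_ℂ‖ ^ 2) (‖x‖ ^ 2) := by
    have h1 := Complex.hasSum_re (v.hasSum_inner_mul_inner x x)
    have e : ∀ i, (⟪x, v i⟫_ℂ * ⟪v i, x⟫_ℂ).re = ‖⟪v i, x⟫_ℂ‖ ^ 2 := fun i => by
      rw [← inner_conj_symm x, ← Complex.normSq_eq_conj_mul_self, Complex.ofReal_re,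
        Complex.normSq_eq_norm_sq]
    simp only [e] at h1
    have h2 : (⟪x, x⟫_ℂ).re = ‖x‖ ^ 2 := inner_self_eq_norm_sq (𝕜 := ℂ) x
    rwa [h2] at h1
  have e : ∀ y : ℝ, 0 ≤ y → ENNReal.ofReal (y ^ 2) = ENNReal.ofReal y ^ 2 := fun y hy =>
    ENNReal.ofReal_pow hy 2
  simp only [← ofReal_norm, ← e _ (norm_nonneg _)]
  rw [← ENNReal.ofReal_tsum_of_nonneg (fun i => by positivity) h.summable, h.tsum_eq]

variable [CompleteSpace H]

lemma tsum_enorm_apply_sq_eq_adjoint {ι κ : Type*} (v : HilbertBasis ι ℂ H)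
    (b : HilbertBasis κ ℂ H) (T : H →L[ℂ] H) :
    ∑' i, ‖T (v i)‖ₑ ^ 2 = ∑' k, ‖T.adjoint (b k)‖ₑ ^ 2 := by
  calc ∑' i, ‖T (v i)‖ₑ ^ 2 = ∑' i, ∑' k, ‖⟪b k, T (v i)⟫_ℂ‖ₑ ^ 2 := by
        simp only [tsum_enorm_inner_sq]
    _ = ∑' k, ∑' i, ‖⟪v i, T.adjoint (b k)⟫_ℂ‖ₑ ^ 2 := by
        rw [ENNReal.tsum_comm]
        refine tsum_congr fun k => tsum_congr fun i => ?_
        rw [ContinuousLinearMap.adjoint_inner_right, ← ofReal_norm, ← ofReal_norm,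
          norm_inner_symm]
    _ = _ := by simp only [tsum_enorm_inner_sq]

/-- The Hilbert-Schmidt norm can be computed in any orthonormal basis. -/
lemma tsum_enorm_apply_sq_eq {ι κ : Type*} (v : HilbertBasis ι ℂ H)
    (b : HilbertBasis κ ℂ H) (T : H →L[ℂ] H) :
    ∑' i, ‖T (v i)‖ₑ ^ 2 = ∑' k, ‖T (b k)‖ₑ ^ 2 :=
  (tsum_enorm_apply_sq_eq_adjoint v v T).trans (tsum_enorm_apply_sq_eq_adjoint b v T).symm

lemma exists_isPositive_factor {T : H →L[ℂ] H} (hT : T.IsPositive) :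
    ∃ S : H →L[ℂ] H, ∀ x y, ⟪x, T y⟫_ℂ = ⟪S x, S y⟫_ℂ := by
  obtain ⟨S, hS⟩ := CStarAlgebra.nonneg_iff_eq_star_mul_self.mp
    ((ContinuousLinearMap.nonneg_iff_isPositive T).mpr hT)
  refine ⟨S, fun x y => ?_⟩
  rw [hS, mul_apply_eq_comp, ContinuousLinearMap.star_eq_adjoint,
    ContinuousLinearMap.adjoint_inner_right]

omit [CompleteSpace H] in
lemma ofReal_re_inner_self (x : H) : ENNReal.ofReal (⟪x, x⟫_ℂ).re = ‖x‖ₑ ^ 2 := by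
  have h2 : (⟪x, x⟫_ℂ).re = ‖x‖ ^ 2 := inner_self_eq_norm_sq (𝕜 := ℂ) x
  rw [h2, ENNReal.ofReal_pow (norm_nonneg x), ofReal_norm]

/-- The trace of a positive operator can be computed in any orthonormal basis. -/
lemma tsum_inner_eq_opTrace {V : ℕ} {ι : Type*} (v : HilbertBasis ι ℂ (Fock V)) {T : Op V}
    (hT : T.IsPositive) : ∑' i, ENNReal.ofReal (⟪v i, T (v i)⟫_ℂ).re = opTrace T := by
  obtain ⟨S, hS⟩ := exists_isPositive_factor hT
  simp only [opTrace, hS, ofReal_re_inner_self]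
  rw [tsum_enorm_apply_sq_eq v (ketBasis V)]
  simp

omit [CompleteSpace H] in
lemma isCompactOperator_rankOne (x y : H) :
    IsCompactOperator (InnerProductSpace.rankOne ℂ x y) := by
  rw [InnerProductSpace.rankOne_def']
  exact (isCompactOperator_of_locallyCompactSpace_rng
    (ContinuousLinearMap.toSpanSingleton ℂ x)).comp_clm (innerSL ℂ y)

/-- A positive operator of finite trace is compact. -/
lemma isCompactOperator_of_opTrace_ne_top {V : ℕ} {T : Op V} (hT : T.IsPositive)
    (htr : opTrace T ≠ ∞) : IsCompactOperator T := by
  obtain ⟨S, hS⟩ := exists_isPositive_factor hT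
  -- `T = S* S` is the sum of the rank one operators `|s k⟩⟨s k|`. Their norms sum to the trace, so
  -- `T` is a norm limit of finite rank operators.
  set s : (Fin V → ℕ) → Fock V := fun k => S.adjoint (ket k) with hs
  have hsum : Summable fun k => ‖s k‖ ^ 2 := by
    have h1 : ∑' k, ‖s k‖ₑ ^ 2 ≠ ∞ := by
      have := tsum_enorm_apply_sq_eq_adjoint (ketBasis V) (ketBasis V) S
      simp only [ketBasis_apply] at this
      rw [hs, ← this]
      simpa only [opTrace, hS, ofReal_re_inner_self] using htr
    simpa using ENNReal.summable_toReal h1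
  have hsum' : Summable fun k => InnerProductSpace.rankOne ℂ (s k) (s k) := by
    refine Summable.of_norm (hsum.congr fun k => ?_)
    rw [InnerProductSpace.norm_rankOne, sq]
  have heq : ∑' k, InnerProductSpace.rankOne ℂ (s k) (s k) = T := by
    ext1 x
    refine ext_inner_left ℂ fun y => ?_
    have h1 : HasSum (fun k => ⟪y, InnerProductSpace.rankOne ℂ (s k) (s k) x⟫_ℂ)
        ⟪y, (∑' k, InnerProductSpace.rankOne ℂ (s k) (s k)) x⟫_ℂ :=
      (hsum'.hasSum.mapL (ContinuousLinearMap.apply ℂ (Fock V) x)).mapL (innerSL ℂ y)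
    refine h1.unique ?_
    rw [hS]
    have h2 := (ketBasis V).hasSum_inner_mul_inner (S y) (S x)
    have e : (fun k => ⟪S y, ketBasis V k⟫_ℂ * ⟪ketBasis V k, S x⟫_ℂ)
        = fun k => ⟪y, InnerProductSpace.rankOne ℂ (s k) (s k) x⟫_ℂ := by
      funext k
      rw [InnerProductSpace.rankOne_apply, inner_smul_right, ketBasis_apply,
        ContinuousLinearMap.adjoint_inner_left, ContinuousLinearMap.adjoint_inner_right, mul_comm]
    rwa [e] at h2
  have hlim : Filter.Tendsto (fun F : Finset (Fin V → ℕ) =>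
      ∑ k ∈ F, InnerProductSpace.rankOne ℂ (s k) (s k)) Filter.atTop (nhds T) := by
    rw [← heq]
    exact hsum'.hasSum
  refine isCompactOperator_of_tendsto hlim (Filter.Eventually.of_forall fun F => ?_)
  exact Submodule.sum_mem (compactOperator (RingHom.id ℂ) (Fock V) (Fock V))
    fun k _ => isCompactOperator_rankOne (s k) (s k)

open ComplexOrder in
/-- A compact positive operator has an orthonormal basis of eigenvectors. -/
lemma exists_hilbertBasis_eigenvectors {H : Type} [NormedAddCommGroup H] [InnerProductSpace ℂ H]
    [CompleteSpace H] {T : H →L[ℂ] H} (hT : T.IsPositive) (hc : IsCompactOperator T) :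
    ∃ (ι : Type) (v : HilbertBasis ι ℂ H) (p : ι → ℝ),
      (∀ i, 0 ≤ p i) ∧ ∀ i, T (v i) = (p i : ℂ) • v i := by
  set E : ℂ → Submodule ℂ H := fun z => Module.End.eigenspace (T : Module.End ℂ H) z with hE
  have hmem : ∀ z (x : H), x ∈ E z ↔ T x = z • x := fun z x => Module.End.mem_eigenspace_iff
  have hclosed : ∀ z, IsClosed (E z : Set H) := fun z => by
    have : (E z : Set H) = {x | T x = z • x} := Set.ext fun x => hmem z x
    rw [this]
    exact isClosed_eq T.continuous (continuous_const_smul z)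
  have : ∀ z, CompleteSpace (E z) := fun z => (hclosed z).completeSpace_coe
  -- The kernel may be infinite dimensional, hence Hilbert bases. Eigenvalues range over `ℂ` here;
  -- positivity makes them real at the end.
  choose w b hb using fun z => exists_hilbertBasis ℂ (E z)
  have horth : Orthonormal ℂ fun a : Σ z, w z => ((b a.1 a.2 : E a.1) : H) :=
    (hT.isSymmetric.orthogonalFamily_eigenspaces).orthonormal_sigma_orthonormal
      (v_family := fun z => b z) fun z => (b z).orthonormal
  have hspan : (Submodule.span ℂ
      (Set.range fun a : Σ z, w z => ((b a.1 a.2 : E a.1) : H)))ᗮ = ⊥ := by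
    rw [eq_bot_iff, ← ContinuousLinearMap.orthogonalComplement_iSup_eigenspaces_eq_bot hc
      hT.isSymmetric]
    intro x hx
    rw [Submodule.mem_orthogonal] at hx
    rw [Submodule.mem_orthogonal']
    intro y hy
    induction hy using Submodule.iSup_induction' with
    | mem z y hy =>
      have h1 := ((b z).hasSum_repr ⟨y, hy⟩).mapL ((innerSL ℂ x).comp (E z).subtypeL)
      refine h1.unique ?_
      have e : (fun i => ((innerSL ℂ x).comp (E z).subtypeL) ((b z).repr ⟨y, hy⟩ i • b z i))
          = fun _ => 0 := by
        funext i
        have := hx (b z i : H) (Submodule.subset_span ⟨⟨z, i⟩, rfl⟩)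
        rw [map_smul]
        have h2 : ((innerSL ℂ x).comp (E z).subtypeL) (b z i) = ⟪x, (b z i : H)⟫_ℂ := rfl
        rw [h2, ← inner_conj_symm, this]
        simp
      rw [e]
      exact hasSum_zero
    | zero => simp
    | add y₁ y₂ _ _ h₁ h₂ => rw [inner_add_right, h₁, h₂, add_zero]
  set v := HilbertBasis.mkOfOrthogonalEqBot horth hspan with hv
  have hvi : ∀ a : Σ z, w z, v a = ((b a.1 a.2 : E a.1) : H) := fun a => by
    rw [hv, HilbertBasis.coe_mkOfOrthogonalEqBot]
  have heig : ∀ a : Σ z, w z, T (v a) = a.1 • v a := fun a => by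
    rw [hvi]
    exact (hmem _ _).mp (b a.1 a.2).2
  have hinner : ∀ a : Σ z, w z, ⟪v a, T (v a)⟫_ℂ = a.1 := fun a => by
    rw [heig, inner_smul_right, inner_self_eq_norm_sq_to_K, v.orthonormal.1 a]
    simp
  have hpos : ∀ a : Σ z, w z, 0 ≤ a.1 := fun a => by
    rw [← hinner a]
    exact hT.inner_nonneg_right _
  refine ⟨_, v, fun a => a.1.re, fun a => (Complex.le_def.mp (hpos a)).1, fun a => ?_⟩
  rw [heig]
  congr 1
  exact Complex.ext rfl (Complex.le_def.mp (hpos a)).2.symm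

end TraceInBases

/-! ### Eigenprojections on eigenvectors. -/

section EigProj

variable {H : Type*} [NormedAddCommGroup H] [InnerProductSpace ℂ H] [CompleteSpace H]

lemma eigProj_apply_of_eq {T : H →L[ℂ] H} {t : ℝ} {v : H} (h : T v = (t : ℂ) • v) :
    eigProj T t v = v := by
  apply Submodule.starProjection_eq_self_iff.mpr
  simp [h]

lemma eigProj_apply_of_ne {T : H →L[ℂ] H} (hT : IsSelfAdjoint T) {s t : ℝ} (hst : s ≠ t) {v : H}
    (h : T v = (s : ℂ) • v) : eigProj T t v = 0 := by
  apply (Submodule.starProjection_apply_eq_zero_iff _).mpr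
  rw [Submodule.mem_orthogonal]
  intro u hu
  have hu' : T u = (t : ℂ) • u := by
    have h0 : T u - (t : ℂ) • u = 0 := hu
    exact sub_eq_zero.mp h0
  have h1 : ⟪T u, v⟫_ℂ = ⟪u, T v⟫_ℂ :=
    ContinuousLinearMap.isSelfAdjoint_iff_isSymmetric.mp hT u v
  rw [hu', h, inner_smul_left, inner_smul_right, Complex.conj_ofReal] at h1
  have h2 : ((t : ℂ) - s) * ⟪u, v⟫_ℂ = 0 := by rw [sub_mul, h1, sub_self]
  rcases mul_eq_zero.mp h2 with h3 | h3
  · exact absurd (by exact_mod_cast (sub_eq_zero.mp h3).symm) hst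
  · exact h3

lemma eigProj_apply {T : H →L[ℂ] H} (hT : IsSelfAdjoint T) {s t : ℝ} {v : H}
    (h : T v = (s : ℂ) • v) : eigProj T t v = if s = t then v else 0 := by
  split_ifs with hst
  · subst hst
    exact eigProj_apply_of_eq h
  · exact eigProj_apply_of_ne hT hst h

lemma eigProj_isSelfAdjoint (T : H →L[ℂ] H) (t : ℝ) : IsSelfAdjoint (eigProj T t) :=
  isSelfAdjoint_starProjection _

end EigProj

/-! ### The reference state is diagonal with explicit weights. -/

section ReferenceState

variable {V : ℕ} {β μ lam : ℝ}

lemma smul_ket_coe (f : (Fin V → ℕ) → ℝ) (k : Fin V → ℕ) :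
    (fun l => (f l : ℂ) * (ket k : Fock V) l) = ((f k : ℂ) • ket k : Fock V) := by
  funext l
  rw [lp.coeFn_smul, Pi.smul_apply, smul_eq_mul]
  rcases eq_or_ne l k with rfl | h
  · rfl
  · rw [ket_apply_of_ne h, mul_zero, mul_zero]

lemma ket_mem_gibbsExponent_domain (hβ : 0 < β) (hlam : 0 < lam ∨ (lam = 0 ∧ μ < 1)) (A : Op V)
    (k : Fin V → ℕ) : ket k ∈ (gibbsExponent β μ lam A).domain := by
  rw [gibbsExponent_domain hβ hlam, smul_ket_coe]
  exact lp.memℓp _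

lemma gibbsExponent_ket (A : Op V) (k : Fin V → ℕ)
    (hk : ket k ∈ (gibbsExponent β μ lam A).domain) :
    gibbsExponent β μ lam A ⟨ket k, hk⟩
      = (β : ℂ) • A (ket k) - (energy β μ lam k : ℂ) • ket k := by
  ext l
  rw [gibbsExponent_apply_apply, lp.coeFn_sub, Pi.sub_apply, ← smul_ket_coe]
  rfl

lemma opExp_gibbsExponent_ket (hβ : 0 < β) (hlam : 0 < lam ∨ (lam = 0 ∧ μ < 1)) {A : Op V}
    (hA : IsSelfAdjoint A) {k : Fin V → ℕ} (hk : A (ket k) = 0) :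
    opExp (gibbsExponent β μ lam A) (ket k) = (Real.exp (-energy β μ lam k) : ℂ) • ket k := by
  refine opExp_apply_eq_smul (hasPositiveResolvent_gibbsExponent hβ hlam hA)
    (ket_mem_gibbsExponent_domain hβ hlam A k) ?_
  rw [gibbsExponent_ket, hk]
  simp

lemma inner_ket_ket (k l : Fin V → ℕ) : ⟪(ket k : Fock V), ket l⟫_ℂ = if k = l then 1 else 0 := by
  rw [inner_ket_left, ket_apply]

lemma opTrace_opExp_gibbsExponent_zero (hβ : 0 < β) (hlam : 0 < lam ∨ (lam = 0 ∧ μ < 1)) :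
    opTrace (opExp (gibbsExponent (V := V) β μ lam 0))
      = ENNReal.ofReal (∑' k : Fin V → ℕ, Real.exp (-energy β μ lam k)) := by
  rw [opTrace, ENNReal.ofReal_tsum_of_nonneg (fun k => (Real.exp_pos _).le)
    (summable_exp_neg_energy hβ hlam)]
  refine tsum_congr fun k => ?_
  rw [opExp_gibbsExponent_ket hβ hlam (IsSelfAdjoint.zero _) rfl, inner_smul_right, inner_ket_ket,
    if_pos rfl, mul_one, Complex.ofReal_re]

/-- The single-mode partition function. -/
def sitePartition (β μ lam : ℝ) : ℝ := ∑' k : Fin 1 → ℕ, Real.exp (-energy β μ lam k)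

lemma sitePartition_pos (hβ : 0 < β) (hlam : 0 < lam ∨ (lam = 0 ∧ μ < 1)) :
    0 < sitePartition β μ lam :=
  (summable_exp_neg_energy hβ hlam).tsum_pos (fun _ => (Real.exp_pos _).le) 0 (Real.exp_pos _)

/-- The eigenvalues of the density matrix of the reference state. -/
def refWeight (β μ lam : ℝ) (k : Fin V → ℕ) : ℝ :=
  Real.exp (-energy β μ lam k) / sitePartition β μ lam ^ V

lemma refWeight_pos (hβ : 0 < β) (hlam : 0 < lam ∨ (lam = 0 ∧ μ < 1)) (k : Fin V → ℕ) :
    0 < refWeight β μ lam k :=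
  div_pos (Real.exp_pos _) (pow_pos (sitePartition_pos hβ hlam) V)

lemma log_refWeight (hβ : 0 < β) (hlam : 0 < lam ∨ (lam = 0 ∧ μ < 1)) (k : Fin V → ℕ) :
    Real.log (refWeight β μ lam k)
      = -energy β μ lam k - V * Real.log (sitePartition β μ lam) := by
  rw [refWeight, Real.log_div (Real.exp_pos _).ne'
    (pow_pos (sitePartition_pos hβ hlam) V).ne', Real.log_exp, Real.log_pow]

lemma summable_refWeight (hβ : 0 < β) (hlam : 0 < lam ∨ (lam = 0 ∧ μ < 1)) :
    Summable fun k : Fin V → ℕ => refWeight β μ lam k :=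
  (summable_exp_neg_energy hβ hlam).div_const _

lemma refWeight_eq_prod (k : Fin V → ℕ) :
    refWeight β μ lam k = ∏ x, refWeight β μ lam (fun _ : Fin 1 => k x) := by
  simp only [refWeight, Finset.prod_div_distrib, ← Real.exp_sum, energy]
  simp [← Finset.mul_sum]

lemma siteDensity_ket (hβ : 0 < β) (hlam : 0 < lam ∨ (lam = 0 ∧ μ < 1)) (k : Fin 1 → ℕ) :
    siteDensity β μ lam (ket k) = (refWeight β μ lam k : ℂ) • ket k := by
  have h0 : opExp (gibbsExponent (V := 1) β μ lam 0) (ket k) = _ :=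
    opExp_gibbsExponent_ket hβ hlam (IsSelfAdjoint.zero _) rfl
  rw [siteDensity, _root_.smul_apply, opTrace_opExp_gibbsExponent_zero hβ hlam, h0,
    ← sitePartition, ENNReal.toReal_ofReal (sitePartition_pos hβ hlam).le, refWeight, pow_one]
  ext l
  simp only [lp.coeFn_smul, Pi.smul_apply, smul_eq_mul, Complex.real_smul]
  push_cast
  ring

/-- The diagonal operator with these weights is a tensor power, and matrix elements determine an
operator, so the choice in `refDensity` must return it. -/
lemma refDensity_ket (hβ : 0 < β) (hlam : 0 < lam ∨ (lam = 0 ∧ μ < 1)) (k : Fin V → ℕ) :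
    refDensity V β μ lam (ket k) = (refWeight β μ lam k : ℂ) • ket k := by
  have hle : ∀ k : Fin V → ℕ, |refWeight β μ lam k| ≤ ∑' l : Fin V → ℕ, refWeight β μ lam l :=
    fun k => by
      rw [abs_of_pos (refWeight_pos hβ hlam k)]
      exact (summable_refWeight hβ hlam).le_tsum k fun l _ => (refWeight_pos hβ hlam l).le
  have hD : IsTensorPower (siteDensity β μ lam) (boundedDiag _ _ hle) := fun k l => by
    simp only [boundedDiag_ket, siteDensity_ket hβ hlam, inner_smul_right, inner_ket_ket]
    rw [Finset.prod_mul_distrib, refWeight_eq_prod l, Complex.ofReal_prod]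
    congr 1
    rw [Finset.prod_ite_zero]
    simp [funext_iff]
  have hex : ∃ S : Op V, IsTensorPower (siteDensity β μ lam) S := ⟨_, hD⟩
  have heq : refDensity V β μ lam = boundedDiag _ _ hle := by
    refine ext_inner_ket fun k l => ?_
    rw [refDensity, dif_pos hex, hex.choose_spec k l, hD k l]
  rw [heq, boundedDiag_ket]

lemma refDensity_isSelfAdjoint (hβ : 0 < β) (hlam : 0 < lam ∨ (lam = 0 ∧ μ < 1)) :
    IsSelfAdjoint (refDensity V β μ lam) := by
  rw [ContinuousLinearMap.isSelfAdjoint_iff']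
  refine ext_inner_ket fun k l => ?_
  rw [ContinuousLinearMap.adjoint_inner_right, refDensity_ket hβ hlam, refDensity_ket hβ hlam,
    inner_smul_left, inner_smul_right, inner_ket_ket, Complex.conj_ofReal]
  split_ifs with h
  · rw [h]
  · simp

end ReferenceState

/-! ### Relative entropy as a double sum over eigenbases. -/

section RelativeEntropy

variable {V : ℕ} {ι : Type} (v : HilbertBasis ι ℂ (Fock V)) {p : ι → ℝ} {ρ σ : Op V}
  {q : (Fin V → ℕ) → ℝ}

lemma hsNormSq_eigProj_mul (hρ : IsSelfAdjoint ρ) (hσ : IsSelfAdjoint σ)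
    (hv : ∀ i, ρ (v i) = (p i : ℂ) • v i) (hq : ∀ k, σ (ket k) = (q k : ℂ) • ket k) (s t : ℝ) :
    hsNormSq (eigProj σ t * eigProj ρ s)
      = ∑' i, ∑' k, if p i = s ∧ q k = t then ‖⟪v i, ket k⟫_ℂ‖ₑ ^ 2 else 0 := by
  have h0 := tsum_enorm_apply_sq_eq v (ketBasis V) (eigProj σ t * eigProj ρ s)
  simp only [ketBasis_apply] at h0
  rw [hsNormSq, ← h0]
  refine tsum_congr fun i => ?_
  rw [mul_apply_eq_comp, eigProj_apply hρ (hv i), ← tsum_enorm_inner_sq (ketBasis V)]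
  refine tsum_congr fun k => ?_
  have h1 : ∀ x, ⟪(ket k : Fock V), eigProj σ t x⟫_ℂ = ⟪eigProj σ t (ket k), x⟫_ℂ := fun x =>
    (ContinuousLinearMap.isSelfAdjoint_iff_isSymmetric.mp (eigProj_isSelfAdjoint σ t) _ _).symm
  rw [ketBasis_apply, h1, eigProj_apply hσ (hq k)]
  by_cases hp : p i = s <;> by_cases hqk : q k = t <;> simp [hp, hqk]
  rw [← ofReal_norm, ← ofReal_norm, norm_inner_symm]

/-- Integration against the spectral measure of the relative modular operator, in eigenbases of
the two density matrices. -/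
lemma lintegral_modularSpectralMeasure (hρ : IsSelfAdjoint ρ) (hσ : IsSelfAdjoint σ)
    (hp0 : ∀ i, 0 ≤ p i)
    (hv : ∀ i, ρ (v i) = (p i : ℂ) • v i) (hq : ∀ k, σ (ket k) = (q k : ℂ) • ket k)
    (g : ℝ → ℝ≥0∞) :
    ∫⁻ t, g t ∂modularSpectralMeasure ρ σ
      = ∑' i, ∑' k, ENNReal.ofReal (p i) * ‖⟪v i, ket k⟫_ℂ‖ₑ ^ 2 * g (q k / p i) := by
  rw [modularSpectralMeasure, MeasureTheory.lintegral_sum_measure]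
  simp only [MeasureTheory.lintegral_smul_measure, MeasureTheory.lintegral_dirac,
    hsNormSq_eigProj_mul v hρ hσ hv hq, smul_eq_mul, ← ENNReal.tsum_mul_left,
    ← ENNReal.tsum_mul_right]
  rw [ENNReal.tsum_comm]
  refine tsum_congr fun i => ?_
  rw [ENNReal.tsum_comm]
  refine tsum_congr fun k => ?_
  -- For fixed `i` and `k` only the index `(p i, q k)` of the spectral measure contributes. It is
  -- absent when `p i = 0`, where the weight on the right vanishes too.
  rcases (hp0 i).eq_or_lt with h | h
  · rw [← h]
    simp only [ENNReal.ofReal_zero, zero_mul, ENNReal.tsum_eq_zero]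
    rintro ⟨⟨s, hs⟩, t⟩
    have : (0 : ℝ) ≠ s := (Set.mem_Ioi.mp hs).ne
    simp [this]
  · rw [tsum_eq_single (⟨⟨p i, h⟩, q k⟩ : Set.Ioi (0 : ℝ) × ℝ)]
    · simp
    · rintro ⟨⟨s, hs⟩, t⟩ hne
      have : ¬ (p i = s ∧ q k = t) := by
        rintro ⟨rfl, rfl⟩
        exact hne rfl
      simp [this]

lemma toENNReal_log_ofReal {t : ℝ} (ht : 0 < t) :
    (ENNReal.log (ENNReal.ofReal t)).toENNReal = ENNReal.ofReal (Real.log t) := by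
  rw [ENNReal.log_ofReal_of_pos ht]
  exact EReal.toENNReal_of_ne_top (EReal.coe_ne_top _)

lemma toENNReal_neg_log_ofReal {t : ℝ} (ht : 0 < t) :
    (-ENNReal.log (ENNReal.ofReal t)).toENNReal = ENNReal.ofReal (-Real.log t) := by
  rw [ENNReal.log_ofReal_of_pos ht, ← EReal.coe_neg]
  exact EReal.toENNReal_of_ne_top (EReal.coe_ne_top _)

/-- The summands `pᵢ |⟨vᵢ, k⟩|² (ln pᵢ - ln q_k)` of the relative entropy. -/
def entropyTerm (v : HilbertBasis ι ℂ (Fock V)) (p : ι → ℝ) (q : (Fin V → ℕ) → ℝ) (i : ι)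
    (k : Fin V → ℕ) : ℝ :=
  p i * ‖⟪v i, ket k⟫_ℂ‖ ^ 2 * (Real.log (p i) - Real.log (q k))

lemma relativeEntropy_eq (hρ : IsSelfAdjoint ρ) (hσ : IsSelfAdjoint σ) (hp0 : ∀ i, 0 ≤ p i)
    (hv : ∀ i, ρ (v i) = (p i : ℂ) • v i) (hq : ∀ k, σ (ket k) = (q k : ℂ) • ket k)
    (hq0 : ∀ k, 0 < q k) :
    relativeEntropy ρ σ
      = ((∑' i, ∑' k, ENNReal.ofReal (entropyTerm v p q i k) : ℝ≥0∞) : EReal)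
        - ((∑' i, ∑' k, ENNReal.ofReal (-entropyTerm v p q i k) : ℝ≥0∞) : EReal) := by
  have hw : ∀ i k, ‖⟪v i, ket k⟫_ℂ‖ₑ ^ 2 = ENNReal.ofReal (‖⟪v i, ket k⟫_ℂ‖ ^ 2) := fun i k => by
    rw [ENNReal.ofReal_pow (norm_nonneg _), ofReal_norm]
  rw [relativeEntropy, lintegral_modularSpectralMeasure v hρ hσ hp0 hv hq,
    lintegral_modularSpectralMeasure v hρ hσ hp0 hv hq]
  have e1 : ∀ i k, ENNReal.ofReal (p i) * ‖⟪v i, ket k⟫_ℂ‖ₑ ^ 2 *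
      (-ENNReal.log (ENNReal.ofReal (q k / p i))).toENNReal
        = ENNReal.ofReal (entropyTerm v p q i k) := fun i k => by
    rcases (hp0 i).eq_or_lt with h | h
    · simp [entropyTerm, ← h]
    · rw [toENNReal_neg_log_ofReal (div_pos (hq0 k) h), hw, ← ENNReal.ofReal_mul h.le,
        ← ENNReal.ofReal_mul (by positivity), Real.log_div (hq0 k).ne' h.ne', entropyTerm]
      congr 1
      ring
  have e2 : ∀ i k, ENNReal.ofReal (p i) * ‖⟪v i, ket k⟫_ℂ‖ₑ ^ 2 *
      (ENNReal.log (ENNReal.ofReal (q k / p i))).toENNReal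
        = ENNReal.ofReal (-entropyTerm v p q i k) := fun i k => by
    rcases (hp0 i).eq_or_lt with h | h
    · simp [entropyTerm, ← h]
    · rw [toENNReal_log_ofReal (div_pos (hq0 k) h), hw, ← ENNReal.ofReal_mul h.le,
        ← ENNReal.ofReal_mul (by positivity), Real.log_div (hq0 k).ne' h.ne', entropyTerm]
      congr 1
      ring
  simp only [e1, e2]

/-- The negative part of the relative entropy is finite. -/
lemma tsum_ofReal_neg_entropyTerm_ne_top (hp0 : ∀ i, 0 ≤ p i) (hq0 : ∀ k, 0 < q k)
    (hqs : Summable q) : ∑' i, ∑' k, ENNReal.ofReal (-entropyTerm v p q i k) ≠ ∞ := by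
  -- From `log x ≤ x - 1` at `x = q k / p i`; summing over `i` with Parseval then leaves `∑ q k`.
  have hle : ∀ i k, ENNReal.ofReal (-entropyTerm v p q i k)
      ≤ ENNReal.ofReal (q k) * ‖⟪v i, ket k⟫_ℂ‖ₑ ^ 2 := fun i k => by
    rw [← ofReal_norm, ← ENNReal.ofReal_pow (norm_nonneg _), ← ENNReal.ofReal_mul (hq0 k).le]
    refine ENNReal.ofReal_le_ofReal ?_
    rcases (hp0 i).eq_or_lt with h | h
    · simp only [entropyTerm, ← h, zero_mul, neg_zero]
      have := hq0 k
      positivity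
    · have h1 := Real.log_le_sub_one_of_pos (div_pos (hq0 k) h)
      rw [Real.log_div (hq0 k).ne' h.ne'] at h1
      have h2 : p i * (Real.log (q k) - Real.log (p i)) ≤ q k := by
        calc _ ≤ p i * (q k / p i) := by gcongr; linarith
          _ = q k := by field_simp
      calc -entropyTerm v p q i k
          = p i * (Real.log (q k) - Real.log (p i)) * ‖⟪v i, ket k⟫_ℂ‖ ^ 2 := by
            rw [entropyTerm]; ring
        _ ≤ _ := by gcongr
  refine ne_top_of_le_ne_top ?_ (ENNReal.tsum_le_tsum fun i => ENNReal.tsum_le_tsum fun k => hle i k)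
  rw [ENNReal.tsum_comm]
  simp only [ENNReal.tsum_mul_left, tsum_enorm_inner_sq]
  have : ∀ k : Fin V → ℕ, ‖(ket k : Fock V)‖ₑ = 1 := fun k => by
    rw [← ofReal_norm, norm_ket, ENNReal.ofReal_one]
  simp only [this, one_pow, mul_one]
  exact hqs.tsum_ofReal_ne_top

end RelativeEntropy

/-! ### Signed sums from finite positive and negative parts. -/

section SignedSums

lemma toReal_ofReal_sub_toReal_ofReal_neg (x : ℝ) :
    (ENNReal.ofReal x).toReal - (ENNReal.ofReal (-x)).toReal = x := by
  rcases le_total 0 x with h | h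
  · rw [ENNReal.toReal_ofReal h, ENNReal.ofReal_of_nonpos (neg_nonpos.mpr h)]
    simp
  · rw [ENNReal.toReal_ofReal (neg_nonneg.mpr h), ENNReal.ofReal_of_nonpos h]
    simp

lemma hasSum_of_tsum_ofReal_ne_top {κ : Type*} {f : κ → ℝ}
    (h1 : ∑' k, ENNReal.ofReal (f k) ≠ ∞) (h2 : ∑' k, ENNReal.ofReal (-f k) ≠ ∞) :
    HasSum f ((∑' k, ENNReal.ofReal (f k)).toReal - (∑' k, ENNReal.ofReal (-f k)).toReal) := by
  have := (ENNReal.hasSum_toReal h1).sub (ENNReal.hasSum_toReal h2)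
  simp only [toReal_ofReal_sub_toReal_ofReal_neg] at this
  rwa [← ENNReal.tsum_toReal_eq (fun k => ENNReal.ofReal_ne_top),
    ← ENNReal.tsum_toReal_eq (fun k => ENNReal.ofReal_ne_top)] at this

lemma hasSum_tsum_of_tsum_ofReal_ne_top {ι κ : Type*} {f : ι → κ → ℝ}
    (h1 : ∑' i, ∑' k, ENNReal.ofReal (f i k) ≠ ∞)
    (h2 : ∑' i, ∑' k, ENNReal.ofReal (-f i k) ≠ ∞) :
    HasSum (fun i => ∑' k, f i k) ((∑' i, ∑' k, ENNReal.ofReal (f i k)).toReal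
      - (∑' i, ∑' k, ENNReal.ofReal (-f i k)).toReal) := by
  have h1' := fun i => ENNReal.ne_top_of_tsum_ne_top h1 i
  have h2' := fun i => ENNReal.ne_top_of_tsum_ne_top h2 i
  have := (ENNReal.hasSum_toReal h1).sub (ENNReal.hasSum_toReal h2)
  rw [← ENNReal.tsum_toReal_eq h1', ← ENNReal.tsum_toReal_eq h2'] at this
  exact this.congr_fun fun i => (hasSum_of_tsum_ofReal_ne_top (h1' i) (h2' i)).tsum_eq

end SignedSums

/-! ### Finite combinations of kets as a form core. -/

section FiniteCombinations

variable {V : ℕ} {β μ lam : ℝ}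

lemma sum_smul_ket_apply (F : Finset (Fin V → ℕ)) (c : (Fin V → ℕ) → ℂ) (l : Fin V → ℕ) :
    (∑ k ∈ F, c k • ket k : Fock V) l = if l ∈ F then c l else 0 := by
  rw [lp.coeFn_sum, Finset.sum_apply]
  simp only [lp.coeFn_smul, Pi.smul_apply, smul_eq_mul, ket_apply, mul_ite, mul_one, mul_zero]
  exact Finset.sum_ite_eq F l c

lemma sum_smul_ket_mem_domain (hβ : 0 < β) (hlam : 0 < lam ∨ (lam = 0 ∧ μ < 1)) (A : Op V)
    (F : Finset (Fin V → ℕ)) (c : (Fin V → ℕ) → ℂ) :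
    ∑ k ∈ F, c k • ket k ∈ (gibbsExponent β μ lam A).domain :=
  Submodule.sum_mem _ fun k _ =>
    Submodule.smul_mem _ _ (ket_mem_gibbsExponent_domain hβ hlam A k)

lemma gibbsExponent_sum_smul_ket (A : Op V) (F : Finset (Fin V → ℕ)) (c : (Fin V → ℕ) → ℂ)
    (h : ∑ k ∈ F, c k • ket k ∈ (gibbsExponent β μ lam A).domain) :
    gibbsExponent β μ lam A ⟨∑ k ∈ F, c k • ket k, h⟩
      = (β : ℂ) • A (∑ k ∈ F, c k • ket k)
        - ∑ k ∈ F, ((energy β μ lam k : ℂ) * c k) • ket k := by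
  ext l
  rw [gibbsExponent_apply_apply, lp.coeFn_sub, Pi.sub_apply, sum_smul_ket_apply,
    sum_smul_ket_apply, lp.coeFn_smul, Pi.smul_apply, smul_eq_mul]
  simp

lemma tendsto_sum_smul_ket (ψ : Fock V) :
    Filter.Tendsto (fun F : Finset (Fin V → ℕ) => ∑ k ∈ F, ψ k • (ket k : Fock V)) Filter.atTop
      (nhds ψ) := by
  have := (ketBasis V).hasSum_repr ψ
  simp only [ketBasis_apply] at this
  exact this

/-- The tangent line inequality for `e^K` extends to the form domain of `K`. -/
lemma form_tangent_le_opExp (hβ : 0 < β) (hlam : 0 < lam ∨ (lam = 0 ∧ μ < 1)) {A : Op V}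
    (hA : IsSelfAdjoint A) {ψ : Fock V} {e : ℝ}
    (he : HasSum (fun k => energy β μ lam k * ‖ψ k‖ ^ 2) e) (c : ℝ) :
    Real.exp c * ((1 - c) * ‖ψ‖ ^ 2 + (β * (⟪ψ, A ψ⟫_ℂ).re - e))
      ≤ (⟪ψ, opExp (gibbsExponent β μ lam A) ψ⟫_ℂ).re := by
  have hlim := tendsto_sum_smul_ket ψ
  have hin : ∀ T : Op V, Filter.Tendsto (fun F : Finset (Fin V → ℕ) =>
      (⟪∑ k ∈ F, ψ k • (ket k : Fock V), T (∑ k ∈ F, ψ k • (ket k : Fock V))⟫_ℂ).re) Filter.atTop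
      (nhds (⟪ψ, T ψ⟫_ℂ).re) := fun T =>
    (Complex.continuous_re.tendsto _).comp (hlim.inner ((T.continuous.tendsto ψ).comp hlim))
  -- `ψ` need not lie in the operator domain, but its finite truncations do. Their energies converge
  -- by `he`, and the other terms are continuous in norm.
  refine le_of_tendsto_of_tendsto'
    ((((hlim.norm.pow 2).const_mul (1 - c)).add
      (((hin A).const_mul β).sub he)).const_mul (Real.exp c)) (hin _) fun F => ?_
  have h := tangent_le_opExp (hasPositiveResolvent_gibbsExponent (μ := μ) hβ hlam hA)
    ⟨_, sum_smul_ket_mem_domain hβ hlam A F ψ⟩ c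
  rw [gibbsExponent_sum_smul_ket] at h
  have horth : Orthonormal ℂ (ket : (Fin V → ℕ) → Fock V) := by
    have := (ketBasis V).orthonormal
    rwa [show ⇑(ketBasis V) = ket from funext ketBasis_apply] at this
  have h2 : (⟪∑ k ∈ F, ψ k • (ket k : Fock V),
      ∑ k ∈ F, ((energy β μ lam k : ℂ) * ψ k) • (ket k : Fock V)⟫_ℂ).re
      = ∑ k ∈ F, energy β μ lam k * ‖ψ k‖ ^ 2 := by
    rw [horth.inner_sum, Complex.re_sum]
    refine Finset.sum_congr rfl fun k _ => ?_
    rw [mul_left_comm, ← Complex.normSq_eq_conj_mul_self, ← Complex.ofReal_mul, Complex.ofReal_re,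
      Complex.normSq_eq_norm_sq]
  rw [inner_sub_right, inner_smul_right, Complex.sub_re, h2, Complex.re_ofReal_mul] at h
  exact h

end FiniteCombinations

/-! ### Normal states in an eigenbasis of the density matrix. -/

section DensityMatrix

variable {V : ℕ} {ι : Type} {v : HilbertBasis ι ℂ (Fock V)} {p : ι → ℝ} {ρ : Op V}
  {φ : Op V →ₗ[ℂ] ℂ}

lemma hasSum_eigenvalues (hρ : IsDensityMatrixOf ρ φ) (hp0 : ∀ i, 0 ≤ p i)
    (hv : ∀ i, ρ (v i) = (p i : ℂ) • v i) : HasSum p 1 := by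
  have h := tsum_inner_eq_opTrace v hρ.1
  have e : ∀ i, (⟪v i, ρ (v i)⟫_ℂ).re = p i := fun i => by
    rw [hv, inner_smul_right, inner_self_eq_norm_sq_to_K, v.orthonormal.1 i]
    simp
  simp only [e] at h
  rw [hρ.2.1] at h
  have h1 := ENNReal.hasSum_toReal (h.trans_ne ENNReal.one_ne_top)
  rw [← ENNReal.tsum_toReal_eq (fun i => ENNReal.ofReal_ne_top), h] at h1
  simpa only [ENNReal.toReal_ofReal (hp0 _), ENNReal.toReal_one] using h1

lemma inner_apply_eq_mul (hρ : ρ.IsPositive) (hv : ∀ i, ρ (v i) = (p i : ℂ) • v i) (x : Fock V)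
    (i : ι) : ⟪v i, ρ x⟫_ℂ = p i * ⟪v i, x⟫_ℂ := by
  rw [← hρ.inner_left_eq_inner_right, hv, inner_smul_left, Complex.conj_ofReal]

/-- A normal state in an eigenbasis of its density matrix. -/
lemma hasSum_state (hρ : IsDensityMatrixOf ρ φ) (hp0 : ∀ i, 0 ≤ p i)
    (hv : ∀ i, ρ (v i) = (p i : ℂ) • v i) (A : Op V) :
    HasSum (fun i => (p i : ℂ) * ⟪v i, A (v i)⟫_ℂ) (φ A) := by
  have hp := hasSum_eigenvalues hρ hp0 hv
  -- The sums over eigenvectors and over kets are the two iterated sums of `f`. It is absolutely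
  -- summable, being dominated by `p i (|(A* v i) k|² + |(v i) k|²)`.
  set f : ι × (Fin V → ℕ) → ℂ := fun ik =>
    p ik.1 * (⟪A.adjoint (v ik.1), ket ik.2⟫_ℂ * ⟪ket ik.2, v ik.1⟫_ℂ) with hf
  have hfi : ∀ i, HasSum (fun k => f (i, k)) ((p i : ℂ) * ⟪v i, A (v i)⟫_ℂ) := fun i => by
    have := ((ketBasis V).hasSum_inner_mul_inner (A.adjoint (v i)) (v i)).mul_left (p i : ℂ)
    simp only [ketBasis_apply] at this
    rwa [ContinuousLinearMap.adjoint_inner_left] at this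
  have hfk : ∀ k, HasSum (fun i => f (i, k)) ⟪ket k, ρ (A (ket k))⟫_ℂ := fun k => by
    have h1 := v.hasSum_inner_mul_inner (ket k) (ρ (A (ket k)))
    have e : ∀ i, ⟪ket k, v i⟫_ℂ * ⟪v i, ρ (A (ket k))⟫_ℂ = f (i, k) := fun i => by
      simp only [inner_apply_eq_mul hρ.1 hv, hf, ContinuousLinearMap.adjoint_inner_left]
      ring
    simpa only [e] using h1
  have hnorm : ∀ x : Fock V, HasSum (fun k => ‖x k‖ ^ 2) (‖x‖ ^ 2) := fun x => by
    simpa using lp.hasSum_norm (p := 2) (by norm_num) x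
  have hb : ∀ i k, ‖f (i, k)‖ ≤ p i * (‖A.adjoint (v i) k‖ ^ 2 + ‖v i k‖ ^ 2) := fun i k => by
    rw [hf]
    simp only [norm_mul, Complex.norm_real, Real.norm_eq_abs, abs_of_nonneg (hp0 i)]
    rw [norm_inner_symm, inner_ket_left, inner_ket_left]
    refine mul_le_mul_of_nonneg_left ?_ (hp0 i)
    nlinarith [sq_nonneg (‖A.adjoint (v i) k‖ - ‖v i k‖), sq_nonneg ‖A.adjoint (v i) k‖,
      sq_nonneg ‖v i k‖]
  have hbs : ∀ i, HasSum (fun k => p i * (‖A.adjoint (v i) k‖ ^ 2 + ‖v i k‖ ^ 2))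
      (p i * (‖A.adjoint (v i)‖ ^ 2 + ‖v i‖ ^ 2)) := fun i =>
    ((hnorm _).add (hnorm _)).mul_left _
  have hsum : Summable f := by
    refine Summable.of_norm_bounded
      (g := fun ik : ι × (Fin V → ℕ) => p ik.1 * (‖A.adjoint (v ik.1) ik.2‖ ^ 2 + ‖v ik.1 ik.2‖ ^ 2))
      ?_ fun ik => hb ik.1 ik.2
    rw [summable_prod_of_nonneg fun ik => mul_nonneg (hp0 _) (by positivity)]
    refine ⟨fun i => (hbs i).summable, ?_⟩
    simp only [(hbs _).tsum_eq]
    refine Summable.of_nonneg_of_le (fun i => mul_nonneg (hp0 i) (by positivity)) (fun i => ?_)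
      (hp.summable.mul_right (‖A.adjoint‖ ^ 2 + 1))
    have h1 : ‖v i‖ = 1 := v.orthonormal.1 i
    have h2 := A.adjoint.le_opNorm (v i)
    rw [h1, mul_one] at h2
    rw [h1, one_pow]
    refine mul_le_mul_of_nonneg_left ?_ (hp0 i)
    gcongr
  have h1 : HasSum (fun i => (p i : ℂ) * ⟪v i, A (v i)⟫_ℂ) (∑' ik, f ik) :=
    hsum.hasSum.prod_fiberwise hfi
  have h2 : HasSum (fun k => ⟪ket k, ρ (A (ket k))⟫_ℂ) (∑' ik, f ik) :=
    HasSum.prod_fiberwise ((Equiv.prodComm _ _).hasSum_iff.mpr hsum.hasSum) hfk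
  rwa [h2.unique (hρ.2.2 A)] at h1

end DensityMatrix

/-! ### Entropy bounds the variational functional. -/

section GibbsBound

variable {V : ℕ} {ι : Type} {v : HilbertBasis ι ℂ (Fock V)} {p : ι → ℝ} {ρ : Op V}
  {φ : Op V →ₗ[ℂ] ℂ} {β μ lam : ℝ}

/-- The tangent at `c = ⟨0|K|0⟩` is a Jensen bound: `⟨0|e^K|0⟩ ≥ e^c > 0`. -/
lemma opTrace_opExp_gibbsExponent_ne_zero (hβ : 0 < β) (hlam : 0 < lam ∨ (lam = 0 ∧ μ < 1))
    {A : Op V} (hA : IsSelfAdjoint A) : opTrace (opExp (gibbsExponent β μ lam A)) ≠ 0 := by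
  rw [opTrace, Ne, ENNReal.tsum_eq_zero]
  intro h
  have h0 := ENNReal.ofReal_eq_zero.mp (h 0)
  have h1 := tangent_le_opExp (hasPositiveResolvent_gibbsExponent (μ := μ) hβ hlam hA)
    ⟨ket 0, ket_mem_gibbsExponent_domain hβ hlam A 0⟩
    (⟪ket 0, gibbsExponent β μ lam A ⟨ket 0, ket_mem_gibbsExponent_domain hβ hlam A 0⟩⟫_ℂ).re
  simp only [norm_ket] at h1
  have h2 := h1.trans h0
  ring_nf at h2
  exact absurd h2 (not_le.mpr (Real.exp_pos _))

/-- The Gibbs variational inequality when the positive part of the entropy is finite. -/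
lemma gibbs_variational_le (hβ : 0 < β) (hlam : 0 < lam ∨ (lam = 0 ∧ μ < 1))
    (hρ : IsDensityMatrixOf ρ φ) (hp0 : ∀ i, 0 ≤ p i) (hv : ∀ i, ρ (v i) = (p i : ℂ) • v i)
    (h1 : ∑' i, ∑' k, ENNReal.ofReal (entropyTerm v p (refWeight β μ lam) i k) ≠ ∞)
    (h2 : ∑' i, ∑' k, ENNReal.ofReal (-entropyTerm v p (refWeight β μ lam) i k) ≠ ∞)
    {A : Op V} (hA : IsSelfAdjoint A) (hT : opTrace (opExp (gibbsExponent β μ lam A)) ≠ ∞) :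
    β * (φ A).re - Real.log (opTrace (opExp (gibbsExponent β μ lam A))).toReal
        + V * Real.log (sitePartition β μ lam)
      ≤ (∑' i, ∑' k, ENNReal.ofReal (entropyTerm v p (refWeight β μ lam) i k)).toReal
        - (∑' i, ∑' k, ENNReal.ofReal (-entropyTerm v p (refWeight β μ lam) i k)).toReal := by
  set G := opExp (gibbsExponent β μ lam A) with hG
  set T := (opTrace G).toReal with hTdef
  have hTpos : 0 < T :=
    ENNReal.toReal_pos (opTrace_opExp_gibbsExponent_ne_zero hβ hlam hA) hT
  set ζ := V * Real.log (sitePartition β μ lam) with hζ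
  have hS := hasSum_tsum_of_tsum_ofReal_ne_top h1 h2
  have hτ : HasSum (fun i => (⟪v i, G (v i)⟫_ℂ).re) T := by
    have h := tsum_inner_eq_opTrace v (opExp_isPositive (K := gibbsExponent β μ lam A))
    have h3 := ENNReal.hasSum_toReal (h.trans_ne hT)
    rw [← ENNReal.tsum_toReal_eq (fun i => ENNReal.ofReal_ne_top), h] at h3
    exact h3.congr_fun fun i =>
      (ENNReal.toReal_ofReal (opExp_isPositive.re_inner_nonneg_right (v i))).symm
  have hp := hasSum_eigenvalues hρ hp0 hv
  have hφ : HasSum (fun i => p i * (⟪v i, A (v i)⟫_ℂ).re) (φ A).re := by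
    have := Complex.hasSum_re (hasSum_state hρ hp0 hv A)
    simpa only [Complex.re_ofReal_mul] using this
  have hle : ∀ i, p i + β * (p i * (⟪v i, A (v i)⟫_ℂ).re) - p i * Real.log T + p i * ζ
      - ∑' k, entropyTerm v p (refWeight β μ lam) i k ≤ (⟪v i, G (v i)⟫_ℂ).re / T := fun i => by
    rcases (hp0 i).eq_or_lt with h | h
    · simp only [entropyTerm, ← h, zero_mul, tsum_zero]
      have : 0 ≤ (⟪v i, G (v i)⟫_ℂ).re := opExp_isPositive.re_inner_nonneg_right (v i)
      simp only [mul_zero, add_zero, sub_zero]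
      positivity
    · have hrow := (hasSum_of_tsum_ofReal_ne_top (ENNReal.ne_top_of_tsum_ne_top h1 i)
        (ENNReal.ne_top_of_tsum_ne_top h2 i)).summable.hasSum
      set s := ∑' k, entropyTerm v p (refWeight β μ lam) i k with hs
      have hw : HasSum (fun k => ‖v i k‖ ^ 2) 1 := by
        have := lp.hasSum_norm (p := 2) (by norm_num) (v i)
        simpa [v.orthonormal.1 i] using this
      -- Finite entropy of row `i` is what puts `v i` in the form domain; its energy is read off
      -- from `s = p i (log (p i) + e + ζ)`.
      have he : HasSum (fun k => energy β μ lam k * ‖v i k‖ ^ 2)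
          ((p i)⁻¹ * s - (Real.log (p i) + ζ) * 1) := by
        have h4 := (hrow.mul_left (p i)⁻¹).sub (hw.mul_left (Real.log (p i) + ζ))
        refine h4.congr_fun fun k => ?_
        rw [entropyTerm, norm_inner_symm, inner_ket_left, log_refWeight hβ hlam]
        field_simp
        ring
      -- This `c` gives the prefactor `p i T`, so that after division by `T` the left side carries
      -- the weights of the state.
      have h5 := form_tangent_le_opExp hβ hlam hA he (Real.log (p i * T))
      rw [Real.exp_log (by positivity), v.orthonormal.1 i, Real.log_mul h.ne' hTpos.ne'] at h5
      rw [le_div_iff₀ hTpos]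
      refine le_trans (le_of_eq ?_) h5
      field_simp
      ring
  have hfin := hasSum_le hle ((((hp.add (hφ.mul_left β)).sub (hp.mul_right (Real.log T))).add
    (hp.mul_right ζ)).sub hS) (hτ.div_const T)
  rw [div_self hTpos.ne'] at hfin
  linarith

end GibbsBound

/-! ### Compressions to finitely many kets, and rank one observables. -/

section Compression

variable {V : ℕ}

/-- An eigenbasis of the compression of a self-adjoint operator to finitely many occupation number
states. -/
lemma exists_compression_eigenbasis {ρ : Op V} (hρ : IsSelfAdjoint ρ) (F : Finset (Fin V → ℕ)) :
    ∃ (n : ℕ) (u : Fin n → Fock V) (r : Fin n → ℝ), Orthonormal ℂ u ∧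
      (∀ j, ∀ l ∉ F, u j l = 0) ∧
      (∀ k ∈ F, ∑ j, ⟪u j, ket k⟫_ℂ • u j = ket k) ∧
      ∀ j l, ⟪u j, ρ (u l)⟫_ℂ = if j = l then (r j : ℂ) else 0 := by
  classical
  set W : Submodule ℂ (Fock V) := Submodule.span ℂ (ket '' (F : Set (Fin V → ℕ))) with hW
  have hfd : FiniteDimensional ℂ W :=
    FiniteDimensional.span_of_finite ℂ (F.finite_toSet.image _)
  set T : W →ₗ[ℂ] W := (W.orthogonalProjectionOnto ∘L ρ ∘L W.subtypeL).toLinearMap with hT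
  have hinner : ∀ x y : W, ⟪x, T y⟫_ℂ = ⟪(x : Fock V), ρ y⟫_ℂ := fun x y =>
    Submodule.inner_orthogonalProjectionOnto_eq_of_mem_left x _
  have hTs : T.IsSymmetric := fun x y => by
    rw [hinner, ← inner_conj_symm, hinner, inner_conj_symm]
    exact ContinuousLinearMap.isSelfAdjoint_iff_isSymmetric.mp hρ _ _
  set b := hTs.eigenvectorBasis rfl with hb
  refine ⟨_, fun j => (b j : Fock V), hTs.eigenvalues rfl,
    b.orthonormal.comp_linearIsometry W.subtypeₗᵢ, fun j l hl => ?_, fun k hk => ?_, fun j l => ?_⟩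
  · rw [← inner_ket_left]
    have h0 : ∀ x ∈ W, ⟪ket l, x⟫_ℂ = 0 := fun x hx => by
      induction hx using Submodule.span_induction with
      | mem x hx =>
        obtain ⟨k, hk, rfl⟩ := hx
        rw [inner_ket_ket, if_neg]
        rintro rfl
        exact hl hk
      | zero => exact inner_zero_right _
      | add x y _ _ hx hy => rw [inner_add_right, hx, hy, add_zero]
      | smul c x _ hx => rw [inner_smul_right, hx, mul_zero]
    exact h0 _ (b j).2
  · have hkW : ket k ∈ W := Submodule.subset_span ⟨k, hk, rfl⟩
    have := congrArg (Subtype.val) (b.sum_repr' ⟨ket k, hkW⟩)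
    simpa using this
  · rw [← hinner, hTs.apply_eigenvectorBasis rfl, inner_smul_right, ← hb,
      orthonormal_iff_ite.mp b.orthonormal]
    split_ifs with h
    · rw [h, mul_one]
      rfl
    · rw [mul_zero]

lemma isSelfAdjoint_real_smul_rankOne (c : ℝ) (x : Fock V) :
    IsSelfAdjoint ((c : ℂ) • InnerProductSpace.rankOne ℂ x x) := by
  refine IsSelfAdjoint.smul (Complex.conj_ofReal c) ?_
  rw [ContinuousLinearMap.isSelfAdjoint_iff', InnerProductSpace.adjoint_rankOne]

lemma state_rankOne {ρ : Op V} {φ : Op V →ₗ[ℂ] ℂ} (hρ : IsDensityMatrixOf ρ φ) (x : Fock V) :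
    φ (InnerProductSpace.rankOne ℂ x x) = ⟪x, ρ x⟫_ℂ := by
  refine (hρ.2.2 _).unique ?_
  have h := (ketBasis V).hasSum_inner_mul_inner x (ρ x)
  refine h.congr_fun fun k => ?_
  rw [InnerProductSpace.rankOne_apply, map_smul, inner_smul_right, ketBasis_apply]

end Compression

/-! ### A finite rank trial operator with prescribed Gibbs exponential. -/

section TrialOperator

variable {V : ℕ} {β μ lam : ℝ} {n : ℕ} {F : Finset (Fin V → ℕ)} {u : Fin n → Fock V}

/-- The bounded operator `A` for which `K_A = β (μ N - ∑ₓ hₓ + A)` has the eigenvectors `u j` with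
eigenvalues `κ j` and agrees with `K_0` on the occupation number states outside `F`. -/
def trialOp (β μ lam : ℝ) (F : Finset (Fin V → ℕ)) (u : Fin n → Fock V) (κ : Fin n → ℝ) : Op V :=
  ((β⁻¹ : ℝ) : ℂ) • (∑ j, (κ j : ℂ) • InnerProductSpace.rankOne ℂ (u j) (u j)
    + ∑ k ∈ F, (energy β μ lam k : ℂ) • InnerProductSpace.rankOne ℂ (ket k) (ket k))

lemma trialOp_isSelfAdjoint (κ : Fin n → ℝ) : IsSelfAdjoint (trialOp β μ lam F u κ) := by
  refine IsSelfAdjoint.smul (Complex.conj_ofReal _) (IsSelfAdjoint.add ?_ ?_)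
  · exact isSelfAdjoint_sum _ fun j _ => isSelfAdjoint_real_smul_rankOne _ _
  · exact isSelfAdjoint_sum _ fun k _ => isSelfAdjoint_real_smul_rankOne _ _

lemma smul_trialOp_apply (hβ : 0 < β) (κ : Fin n → ℝ) (x : Fock V) :
    (β : ℂ) • trialOp β μ lam F u κ x
      = ∑ j, ((κ j : ℂ) * ⟪u j, x⟫_ℂ) • u j + ∑ k ∈ F, ((energy β μ lam k : ℂ) * x k) • ket k := by
  have hβ' : (β : ℂ) ≠ 0 := by exact_mod_cast hβ.ne'
  simp only [trialOp, _root_.smul_apply, _root_.add_apply, _root_.sum_apply,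
    InnerProductSpace.rankOne_apply, smul_smul, inner_ket_left]
  rw [Complex.ofReal_inv, mul_inv_cancel₀ hβ', one_smul]

lemma eq_sum_smul_ket {x : Fock V} (hx : ∀ l ∉ F, x l = 0) : x = ∑ k ∈ F, x k • ket k := by
  ext l
  rw [sum_smul_ket_apply]
  split_ifs with h
  · rfl
  · exact hx l h

/-- On the span of the kets in `F` the energies put into `trialOp` cancel those of `K_0`, leaving
only `κ`. -/
lemma opExp_trialOp_eigenvector (hβ : 0 < β) (hlam : 0 < lam ∨ (lam = 0 ∧ μ < 1))
    (hu : Orthonormal ℂ u) (hF : ∀ j, ∀ l ∉ F, u j l = 0) (κ : Fin n → ℝ) (j : Fin n) :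
    opExp (gibbsExponent β μ lam (trialOp β μ lam F u κ)) (u j)
      = (Real.exp (κ j) : ℂ) • u j := by
  have hmem := sum_smul_ket_mem_domain (μ := μ) hβ hlam (trialOp β μ lam F u κ) F (u j)
  have hK := gibbsExponent_sum_smul_ket (trialOp β μ lam F u κ) F (u j) hmem
  simp only [← eq_sum_smul_ket (hF j)] at hmem hK
  refine opExp_apply_eq_smul
    (hasPositiveResolvent_gibbsExponent hβ hlam (trialOp_isSelfAdjoint κ)) hmem ?_
  rw [hK, smul_trialOp_apply hβ, add_sub_cancel_right]
  simp [orthonormal_iff_ite.mp hu]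

lemma opExp_trialOp_ket (hβ : 0 < β) (hlam : 0 < lam ∨ (lam = 0 ∧ μ < 1))
    (hF : ∀ j, ∀ l ∉ F, u j l = 0) (κ : Fin n → ℝ) {k : Fin V → ℕ} (hk : k ∉ F) :
    opExp (gibbsExponent β μ lam (trialOp β μ lam F u κ)) (ket k)
      = (Real.exp (-energy β μ lam k) : ℂ) • ket k := by
  refine opExp_gibbsExponent_ket hβ hlam (trialOp_isSelfAdjoint κ) ?_
  have hβ' : (β : ℂ) ≠ 0 := by exact_mod_cast hβ.ne'
  have h : (β : ℂ) • trialOp β μ lam F u κ (ket k) = 0 := by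
    rw [smul_trialOp_apply hβ, Finset.sum_eq_zero, Finset.sum_eq_zero, add_zero]
    · intro l hl
      have hne : l ≠ k := fun h => hk (h ▸ hl)
      rw [ket_apply_of_ne hne, mul_zero, zero_smul]
    · intro j _
      rw [← inner_conj_symm, inner_ket_left, hF j k hk, map_zero, mul_zero, zero_smul]
  exact (smul_eq_zero.mp h).resolve_left hβ'

lemma sum_norm_sq_of_support {x : Fock V} (hx : ∀ l ∉ F, x l = 0) :
    ∑ k ∈ F, ‖x k‖ ^ 2 = ‖x‖ ^ 2 := by
  have h1 : HasSum (fun k => ‖x k‖ ^ 2) (‖x‖ ^ 2) := by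
    simpa using lp.hasSum_norm (p := 2) (by norm_num) x
  refine (hasSum_sum_of_ne_finset_zero fun l hl => ?_).unique h1
  simp [hx l hl]

/-- Only the diagonal entries in `F` differ from those at `A = 0`, so the trace is a finite
correction of a convergent series. -/
lemma opTrace_opExp_trialOp (hβ : 0 < β) (hlam : 0 < lam ∨ (lam = 0 ∧ μ < 1))
    (hu : Orthonormal ℂ u) (hF : ∀ j, ∀ l ∉ F, u j l = 0)
    (hsp : ∀ k ∈ F, ∑ j, ⟪u j, ket k⟫_ℂ • u j = ket k) (κ : Fin n → ℝ) :
    opTrace (opExp (gibbsExponent β μ lam (trialOp β μ lam F u κ)))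
      = ENNReal.ofReal (∑ j, Real.exp (κ j)
        + (∑' k : Fin V → ℕ, Real.exp (-energy β μ lam k) - ∑ k ∈ F, Real.exp (-energy β μ lam k))) := by
  set G := opExp (gibbsExponent β μ lam (trialOp β μ lam F u κ)) with hG
  have hGpos : G.IsPositive := opExp_isPositive
  have hin : ∀ k ∈ F, (⟪ket k, G (ket k)⟫_ℂ).re = ∑ j, Real.exp (κ j) * ‖u j k‖ ^ 2 := by
    intro k hk
    have h1 : G (ket k) = ∑ j, ((Real.exp (κ j) : ℂ) * ⟪u j, ket k⟫_ℂ) • u j := by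
      conv_lhs => rw [← hsp k hk]
      rw [map_sum]
      refine Finset.sum_congr rfl fun j _ => ?_
      rw [map_smul, opExp_trialOp_eigenvector hβ hlam hu hF, smul_smul, mul_comm]
    rw [h1, inner_sum, Complex.re_sum]
    refine Finset.sum_congr rfl fun j _ => ?_
    rw [inner_smul_right, mul_assoc, ← inner_conj_symm, inner_ket_left,
      ← Complex.normSq_eq_conj_mul_self, ← Complex.ofReal_mul, Complex.ofReal_re,
      Complex.normSq_eq_norm_sq]
  have hout : ∀ k ∉ F, (⟪ket k, G (ket k)⟫_ℂ).re = Real.exp (-energy β μ lam k) := by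
    intro k hk
    rw [hG, opExp_trialOp_ket hβ hlam hF κ hk, inner_smul_right, inner_ket_ket, if_pos rfl, mul_one,
      Complex.ofReal_re]
  have hdiff : HasSum (fun k => (⟪ket k, G (ket k)⟫_ℂ).re - Real.exp (-energy β μ lam k))
      (∑ k ∈ F, ((⟪ket k, G (ket k)⟫_ℂ).re - Real.exp (-energy β μ lam k))) :=
    hasSum_sum_of_ne_finset_zero fun k hk => by rw [hout k hk, sub_self]
  have hsum : HasSum (fun k => (⟪ket k, G (ket k)⟫_ℂ).re) (∑ j, Real.exp (κ j)
        + (∑' k : Fin V → ℕ, Real.exp (-energy β μ lam k) - ∑ k ∈ F, Real.exp (-energy β μ lam k))) := by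
    have h := (summable_exp_neg_energy (V := V) (μ := μ) hβ hlam).hasSum.add hdiff
    simp only [add_sub_cancel] at h
    convert h using 1
    rw [Finset.sum_sub_distrib, Finset.sum_congr rfl hin, Finset.sum_comm]
    have : ∀ j, ∑ k ∈ F, Real.exp (κ j) * ‖u j k‖ ^ 2 = Real.exp (κ j) := fun j => by
      rw [← Finset.mul_sum, sum_norm_sq_of_support (hF j), hu.1 j]
      simp
    rw [Finset.sum_congr rfl fun j _ => this j]
    ring
  have hnn : ∀ k, 0 ≤ (⟪ket k, G (ket k)⟫_ℂ).re := fun k => hGpos.re_inner_nonneg_right (ket k)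
  rw [← hsum.tsum_eq, ENNReal.ofReal_tsum_of_nonneg hnn hsum.summable]
  rfl

lemma state_trialOp (hβ : 0 < β) {ρ : Op V} {φ : Op V →ₗ[ℂ] ℂ} (hρ : IsDensityMatrixOf ρ φ)
    (κ : Fin n → ℝ) :
    β * (φ (trialOp β μ lam F u κ)).re
      = ∑ j, κ j * (⟪u j, ρ (u j)⟫_ℂ).re
        + ∑ k ∈ F, energy β μ lam k * (⟪ket k, ρ (ket k)⟫_ℂ).re := by
  simp only [trialOp, map_smul, map_add, map_sum, state_rankOne hρ, smul_eq_mul,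
    Complex.re_ofReal_mul, Complex.add_re, Complex.re_sum]
  rw [mul_inv_cancel_left₀ hβ.ne']

end TrialOperator

/-! ### Klein's inequality for compressions. -/

section Klein

variable {V : ℕ} {ι : Type} {v : HilbertBasis ι ℂ (Fock V)} {p : ι → ℝ} {ρ : Op V}
  {φ : Op V →ₗ[ℂ] ℂ} {n : ℕ} {F : Finset (Fin V → ℕ)} {u : Fin n → Fock V} {r : Fin n → ℝ}

lemma hasSum_inner_apply_self (hρ : ρ.IsPositive) (hv : ∀ i, ρ (v i) = (p i : ℂ) • v i)
    (x : Fock V) : HasSum (fun i => p i * ‖⟪v i, x⟫_ℂ‖ ^ 2) (⟪x, ρ x⟫_ℂ).re := by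
  have h := Complex.hasSum_re (v.hasSum_inner_mul_inner x (ρ x))
  refine h.congr_fun fun i => ?_
  rw [inner_apply_eq_mul hρ hv, mul_left_comm, Complex.re_ofReal_mul, ← inner_conj_symm x,
    ← Complex.normSq_eq_conj_mul_self, Complex.ofReal_re, Complex.normSq_eq_norm_sq]

/-- In operator terms `p i ⟨v i, P (PρP + δ)⁻¹ P v i⟩ ≤ 1`, because `ρ ≥ p i |v i⟩⟨v i|`. Testing
this in `x = (PρP + δ)⁻¹ P v i`, where `P` projects onto the span of the `u j`, gives `p i X² ≤ ⟨x,
ρ x⟩ ≤ X`. -/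
lemma sum_norm_inner_sq_le_one (hρ : ρ.IsPositive) (hp0 : ∀ i, 0 ≤ p i)
    (hv : ∀ i, ρ (v i) = (p i : ℂ) • v i)
    (hr : ∀ j l, ⟪u j, ρ (u l)⟫_ℂ = if j = l then (r j : ℂ) else 0)
    (hr0 : ∀ j, 0 ≤ r j) {δ : ℝ} (hδ : 0 < δ) (i : ι) :
    p i * ∑ j, ‖⟪v i, u j⟫_ℂ‖ ^ 2 / (r j + δ) ≤ 1 := by
  have hpos : ∀ j, 0 < r j + δ := fun j => add_pos_of_nonneg_of_pos (hr0 j) hδ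
  set X := ∑ j, ‖⟪v i, u j⟫_ℂ‖ ^ 2 / (r j + δ) with hX
  have hX0 : 0 ≤ X := Finset.sum_nonneg fun j _ => div_nonneg (by positivity) (hpos j).le
  set c : Fin n → ℂ := fun j => ⟪u j, v i⟫_ℂ / ((r j + δ : ℝ) : ℂ) with hc
  set x : Fock V := ∑ j, c j • u j with hx
  have h1 : ⟪v i, x⟫_ℂ = (X : ℂ) := by
    rw [hx, inner_sum, hX, Complex.ofReal_sum]
    refine Finset.sum_congr rfl fun j _ => ?_
    rw [inner_smul_right]
    simp only [hc]
    rw [← inner_conj_symm (u j), div_mul_eq_mul_div,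
      ← Complex.normSq_eq_conj_mul_self, Complex.normSq_eq_norm_sq, ← Complex.ofReal_div]
  have h2 : (⟪x, ρ x⟫_ℂ).re ≤ X := by
    have e : ⟪x, ρ x⟫_ℂ = ((∑ j, ‖c j‖ ^ 2 * r j : ℝ) : ℂ) := by
      rw [hx, map_sum, sum_inner, Complex.ofReal_sum]
      refine Finset.sum_congr rfl fun j _ => ?_
      rw [inner_sum, Finset.sum_eq_single j]
      · rw [map_smul, inner_smul_left, inner_smul_right, hr, if_pos rfl, ← mul_assoc,
          ← Complex.normSq_eq_conj_mul_self, Complex.normSq_eq_norm_sq, ← Complex.ofReal_mul]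
      · intro l _ hl
        rw [map_smul, inner_smul_left, inner_smul_right, hr, if_neg hl.symm, mul_zero, mul_zero]
      · exact fun h => absurd (Finset.mem_univ j) h
    rw [e, Complex.ofReal_re]
    refine Finset.sum_le_sum fun j _ => ?_
    rw [hc, norm_div, Complex.norm_real, Real.norm_eq_abs, abs_of_pos (hpos j), norm_inner_symm,
      div_pow, div_mul_eq_mul_div, div_le_div_iff₀ (pow_pos (hpos j) 2) (hpos j), mul_assoc]
    refine mul_le_mul_of_nonneg_left ?_ (by positivity)
    nlinarith [hpos j, hr0 j]
  have h3 := le_hasSum (hasSum_inner_apply_self hρ hv x) i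
    fun l _ => mul_nonneg (hp0 l) (by positivity)
  rw [h1, Complex.norm_real, Real.norm_eq_abs, sq_abs] at h3
  rcases hX0.eq_or_lt with h | h
  · rw [← h, mul_zero]
    exact zero_le_one
  · have h4 : p i * X * X ≤ 1 * X := by nlinarith
    exact le_of_mul_le_mul_right h4 h

/-- Klein's inequality for the compression of a density matrix. -/
lemma klein_compression_le (hρ : IsDensityMatrixOf ρ φ) (hp0 : ∀ i, 0 ≤ p i)
    (hv : ∀ i, ρ (v i) = (p i : ℂ) • v i)
    (hr : ∀ j l, ⟪u j, ρ (u l)⟫_ℂ = if j = l then (r j : ℂ) else 0)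
    (hr0 : ∀ j, 0 ≤ r j) {δ : ℝ} (hδ : 0 < δ) {η : ℝ}
    (hη : HasSum (fun i => p i * Real.log (p i) * ∑ j, ‖⟪v i, u j⟫_ℂ‖ ^ 2) η) :
    η ≤ ∑ j, Real.log (r j + δ) * r j + 1 - ∑ j, r j := by
  have hpos : ∀ j, 0 < r j + δ := fun j => add_pos_of_nonneg_of_pos (hr0 j) hδ
  have hrow : ∀ j, HasSum (fun i => p i * ‖⟪v i, u j⟫_ℂ‖ ^ 2) (r j) := fun j => by
    have := hasSum_inner_apply_self hρ.1 hv (u j)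
    rwa [hr, if_pos rfl, Complex.ofReal_re] at this
  have h1 := hasSum_sum (s := Finset.univ) fun j _ => (hrow j).mul_left (Real.log (r j + δ))
  have h2 := hasSum_sum (s := Finset.univ) fun j _ => hrow j
  refine hasSum_le (fun i => ?_) hη ((h1.add (hasSum_eigenvalues hρ hp0 hv)).sub h2)
  -- This is `log y ≤ y - 1` at `y = p i / (r j + δ)`, with `δ` guarding against `r j = 0`. Summed
  -- over `j`, the quadratic term is at most `p i`, the source of the `1` in the bound.
  have key : ∀ j, p i * Real.log (p i) * ‖⟪v i, u j⟫_ℂ‖ ^ 2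
      ≤ Real.log (r j + δ) * (p i * ‖⟪v i, u j⟫_ℂ‖ ^ 2)
        + p i * (p i * (‖⟪v i, u j⟫_ℂ‖ ^ 2 / (r j + δ))) - p i * ‖⟪v i, u j⟫_ℂ‖ ^ 2 := fun j => by
    rcases (hp0 i).eq_or_lt with h | h
    · simp [← h]
    · have h3 := Real.log_le_sub_one_of_pos (div_pos h (hpos j))
      rw [Real.log_div h.ne' (hpos j).ne'] at h3
      have h4 := mul_le_mul_of_nonneg_left h3
        (mul_nonneg h.le (sq_nonneg ‖⟪v i, u j⟫_ℂ‖))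
      have e : p i * ‖⟪v i, u j⟫_ℂ‖ ^ 2 * (p i / (r j + δ))
          = p i * (p i * (‖⟪v i, u j⟫_ℂ‖ ^ 2 / (r j + δ))) := by ring
      linarith
  have hB := mul_le_mul_of_nonneg_left (sum_norm_inner_sq_le_one hρ.1 hp0 hv hr hr0 hδ i) (hp0 i)
  have hS := Finset.sum_le_sum fun j (_ : j ∈ Finset.univ) => key j
  rw [Finset.sum_sub_distrib, Finset.sum_add_distrib, ← Finset.mul_sum, ← Finset.mul_sum,
    ← Finset.mul_sum] at hS
  linarith

end Klein

/-! ### The two inequalities of the variational principle. -/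

section VariationalPrinciple

variable {V : ℕ} {ι : Type} {v : HilbertBasis ι ℂ (Fock V)} {p : ι → ℝ} {ρ : Op V}
  {φ : Op V →ₗ[ℂ] ℂ} {β μ lam : ℝ}

/-- The functional `ρ, A ↦ β φ(A) - ln Tr e^{β (μ N - ∑ₓ hₓ + A)}`. -/
def variationalValue (β μ lam : ℝ) (φ : Op V →ₗ[ℂ] ℂ) (A : Op V) : EReal :=
  ((β * (φ A).re : ℝ) : EReal) - ENNReal.log (opTrace (opExp (gibbsExponent β μ lam A)))

lemma variationalValue_eq {A : Op V} {t : ℝ} (ht : 0 < t)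
    (hA : opTrace (opExp (gibbsExponent β μ lam A)) = ENNReal.ofReal t) :
    variationalValue β μ lam φ A = ((β * (φ A).re - Real.log t : ℝ) : EReal) := by
  rw [variationalValue, hA, ENNReal.log_ofReal_of_pos ht, EReal.coe_sub]

lemma hasSum_inner_sq_row (v : HilbertBasis ι ℂ (Fock V)) (k : Fin V → ℕ) :
    HasSum (fun i => ‖⟪v i, ket k⟫_ℂ‖ ^ 2) 1 := by
  have h : HasSum (fun i => ⟪ket k, v i⟫_ℂ * ⟪v i, ket k⟫_ℂ) ⟪(ket k : Fock V), ket k⟫_ℂ :=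
    v.hasSum_inner_mul_inner (ket k) (ket k)
  rw [inner_ket_ket, if_pos rfl] at h
  refine (Complex.hasSum_re h).congr_fun fun i => ?_
  rw [← inner_conj_symm (ket k), ← Complex.normSq_eq_conj_mul_self, Complex.ofReal_re,
    Complex.normSq_eq_norm_sq]

/-- For fixed `k` this holds even if the total entropy is infinite, since `|p log p| ≤ 1` on `[0,
1]`. Hence the lower bound on the supremum sums over `i` first. -/
lemma summable_mul_log (hρ : IsDensityMatrixOf ρ φ) (hp0 : ∀ i, 0 ≤ p i)
    (hv : ∀ i, ρ (v i) = (p i : ℂ) • v i) (k : Fin V → ℕ) :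
    Summable fun i => p i * Real.log (p i) * ‖⟪v i, ket k⟫_ℂ‖ ^ 2 := by
  have hp := hasSum_eigenvalues hρ hp0 hv
  refine Summable.of_norm_bounded (hasSum_inner_sq_row v k).summable fun i => ?_
  rw [norm_mul, Real.norm_eq_abs, norm_pow, norm_norm]
  refine mul_le_of_le_one_left (by positivity) ?_
  rcases (hp0 i).eq_or_lt with h | h
  · simp [← h]
  · rw [mul_comm]
    exact (Real.abs_log_mul_self_lt _ h (le_hasSum hp i fun l _ => hp0 l)).le

lemma hasSum_entropyTerm (hβ : 0 < β) (hlam : 0 < lam ∨ (lam = 0 ∧ μ < 1))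
    (hρ : IsDensityMatrixOf ρ φ) (hp0 : ∀ i, 0 ≤ p i)
    (hv : ∀ i, ρ (v i) = (p i : ℂ) • v i) (k : Fin V → ℕ) :
    HasSum (fun i => entropyTerm v p (refWeight β μ lam) i k)
      (∑' i, p i * Real.log (p i) * ‖⟪v i, ket k⟫_ℂ‖ ^ 2
        + (energy β μ lam k + V * Real.log (sitePartition β μ lam)) * (⟪ket k, ρ (ket k)⟫_ℂ).re) := by
  refine ((summable_mul_log hρ hp0 hv k).hasSum.add
    ((hasSum_inner_apply_self hρ.1 hv (ket k)).mul_left _)).congr_fun fun i => ?_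
  rw [entropyTerm, log_refWeight hβ hlam]
  ring

/-- Both sides are `‖P x‖²` for the projection `P` onto the span of the kets in `F`, computed in two
bases. -/
lemma sum_norm_inner_sq_eq {n : ℕ} {F : Finset (Fin V → ℕ)} {u : Fin n → Fock V}
    (hF : ∀ j, ∀ l ∉ F, u j l = 0)
    (hsp : ∀ k ∈ F, ∑ j, ⟪u j, ket k⟫_ℂ • u j = ket k) (x : Fock V) :
    ∑ j, ‖⟪x, u j⟫_ℂ‖ ^ 2 = ∑ k ∈ F, ‖⟪x, ket k⟫_ℂ‖ ^ 2 := by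
  have h1 : ∀ k ∈ F, ‖⟪x, ket k⟫_ℂ‖ ^ 2
      = ∑ j, (⟪u j, ket k⟫_ℂ * ⟪x, u j⟫_ℂ * ⟪ket k, x⟫_ℂ).re := fun k hk => by
    have h2 : ⟪x, ket k⟫_ℂ = ∑ j, ⟪u j, ket k⟫_ℂ * ⟪x, u j⟫_ℂ := by
      conv_lhs => rw [← hsp k hk]
      rw [inner_sum]
      exact Finset.sum_congr rfl fun j _ => inner_smul_right _ _ _
    rw [← Complex.re_sum, ← Finset.sum_mul, ← h2, ← inner_conj_symm (ket k), Complex.mul_conj,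
      Complex.ofReal_re, Complex.normSq_eq_norm_sq]
  rw [Finset.sum_congr rfl h1, Finset.sum_comm]
  refine Finset.sum_congr rfl fun j _ => ?_
  have h3 : ⟪u j, x⟫_ℂ = ∑ k ∈ F, ⟪u j, ket k⟫_ℂ * ⟪ket k, x⟫_ℂ := by
    conv_lhs => rw [eq_sum_smul_ket (hF j)]
    rw [sum_inner]
    refine Finset.sum_congr rfl fun k _ => ?_
    rw [inner_smul_left, ← inner_ket_left, inner_conj_symm]
  rw [← Complex.re_sum]
  have h4 : ∑ k ∈ F, ⟪u j, ket k⟫_ℂ * ⟪x, u j⟫_ℂ * ⟪ket k, x⟫_ℂ = ⟪x, u j⟫_ℂ * ⟪u j, x⟫_ℂ := by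
    rw [h3, Finset.mul_sum]
    exact Finset.sum_congr rfl fun k _ => by ring
  rw [h4, ← inner_conj_symm (u j), Complex.mul_conj, Complex.ofReal_re, Complex.normSq_eq_norm_sq]

/-- The value of the variational functional at the trial operator that makes `e^K` agree with
`P ρ P + δ` on the span of finitely many occupation number states. -/
lemma exists_le_variationalValue (hβ : 0 < β) (hlam : 0 < lam ∨ (lam = 0 ∧ μ < 1))
    (hρ : IsDensityMatrixOf ρ φ) (hp0 : ∀ i, 0 ≤ p i)
    (hv : ∀ i, ρ (v i) = (p i : ℂ) • v i) (F : Finset (Fin V → ℕ)) :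
    ∃ n : ℕ, ∀ δ : ℝ, 0 < δ → ∃ A : Op V, IsSelfAdjoint A ∧
      ((∑ k ∈ F, ∑' i, entropyTerm v p (refWeight β μ lam) i k
        + V * Real.log (sitePartition β μ lam) * (1 - ∑ k ∈ F, (⟪ket k, ρ (ket k)⟫_ℂ).re)
        - (∑' k : Fin V → ℕ, Real.exp (-energy β μ lam k)
          - ∑ k ∈ F, Real.exp (-energy β μ lam k)) - n * δ
        - V * Real.log (sitePartition β μ lam) : ℝ) : EReal) ≤ variationalValue β μ lam φ A := by
  obtain ⟨n, u, r, hu, hF, hsp, hr⟩ := exists_compression_eigenbasis hρ.1.isSelfAdjoint F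
  refine ⟨n, fun δ hδ => ?_⟩
  have hr0 : ∀ j, 0 ≤ r j := fun j => by
    have := hρ.1.re_inner_nonneg_right (u j)
    rwa [hr, if_pos rfl] at this
  have hpos : ∀ j, 0 < r j + δ := fun j => add_pos_of_nonneg_of_pos (hr0 j) hδ
  set κ : Fin n → ℝ := fun j => Real.log (r j + δ) with hκ
  set tail := ∑' k : Fin V → ℕ, Real.exp (-energy β μ lam k)
    - ∑ k ∈ F, Real.exp (-energy β μ lam k) with htail
  set t := ∑ j, Real.exp (κ j) + tail with ht
  have htr := opTrace_opExp_trialOp hβ hlam hu hF hsp κ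
  have hA := trialOp_isSelfAdjoint (β := β) (μ := μ) (lam := lam) (F := F) (u := u) κ
  have htpos : 0 < t := by
    have h := opTrace_opExp_gibbsExponent_ne_zero hβ hlam hA
    rw [htr] at h
    exact ENNReal.ofReal_pos.mp (pos_iff_ne_zero.mpr h)
  refine ⟨_, hA, ?_⟩
  rw [variationalValue_eq htpos htr, EReal.coe_le_coe_iff, state_trialOp hβ hρ]
  have ht2 : t = ∑ j, r j + n * δ + tail := by
    rw [ht]
    simp only [hκ, Real.exp_log (hpos _), Finset.sum_add_distrib]
    simp
  -- The loss `t - 1 = ∑ r j + nδ + tail - 1` cancels the slack `1 - ∑ r j` of Klein's inequality up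
  -- to `nδ + tail`.
  have hlog := Real.log_le_sub_one_of_pos htpos
  have hrj : ∀ j, (⟪u j, ρ (u j)⟫_ℂ).re = r j := fun j => by
    rw [hr, if_pos rfl, Complex.ofReal_re]
  simp only [hrj]
  have hN := sum_norm_inner_sq_eq hF hsp
  have hη : HasSum (fun i => p i * Real.log (p i) * ∑ j, ‖⟪v i, u j⟫_ℂ‖ ^ 2)
      (∑ k ∈ F, ∑' i, p i * Real.log (p i) * ‖⟪v i, ket k⟫_ℂ‖ ^ 2) := by
    refine (hasSum_sum fun k _ => (summable_mul_log hρ hp0 hv k).hasSum).congr_fun fun i => ?_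
    rw [hN, Finset.mul_sum]
  have hR : ∑ j, r j = ∑ k ∈ F, (⟪ket k, ρ (ket k)⟫_ℂ).re := by
    have h1 := hasSum_sum (s := Finset.univ) fun j _ => hasSum_inner_apply_self hρ.1 hv (u j)
    have h2 := hasSum_sum (s := F) fun k _ => hasSum_inner_apply_self hρ.1 hv (ket k)
    simp only [← Finset.mul_sum, hN, hrj] at h1 h2
    exact h1.unique h2
  have hK := klein_compression_le hρ hp0 hv hr hr0 hδ hη
  simp only [(hasSum_entropyTerm hβ hlam hρ hp0 hv _).tsum_eq, Finset.sum_add_distrib, add_mul,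
    ← Finset.mul_sum]
  rw [hR] at hK ht2
  linarith

lemma coe_le_of_forall_sub_mul_le {x c : ℝ} {M : EReal}
    (h : ∀ δ : ℝ, 0 < δ → ((x - c * δ : ℝ) : EReal) ≤ M) : (x : EReal) ≤ M := by
  have hlim : Filter.Tendsto (fun δ : ℝ => ((x - c * δ : ℝ) : EReal)) (nhdsWithin 0 (Set.Ioi 0))
      (nhds (x : EReal)) := by
    refine (continuous_coe_real_ereal.tendsto x).comp ?_
    have : Filter.Tendsto (fun δ : ℝ => x - c * δ) (nhds 0) (nhds (x - c * 0)) :=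
      Continuous.tendsto (by fun_prop) 0
    rw [mul_zero, sub_zero] at this
    exact this.mono_left nhdsWithin_le_nhds
  refine le_of_tendsto hlim ?_
  filter_upwards [self_mem_nhdsWithin] with δ hδ using h δ hδ

lemma coe_mul_log_opTrace (hβ : 0 < β) (hlam : 0 < lam ∨ (lam = 0 ∧ μ < 1)) :
    (V : EReal) * ENNReal.log (opTrace (opExp (gibbsExponent (V := 1) β μ lam 0)))
      = ((V * Real.log (sitePartition β μ lam) : ℝ) : EReal) := by
  rw [opTrace_opExp_gibbsExponent_zero hβ hlam, ← sitePartition,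
    ENNReal.log_ofReal_of_pos (sitePartition_pos hβ hlam), EReal.coe_mul]
  rfl

lemma sum_entropyTerm_le_iSup (hβ : 0 < β) (hlam : 0 < lam ∨ (lam = 0 ∧ μ < 1))
    (hρ : IsDensityMatrixOf ρ φ) (hp0 : ∀ i, 0 ≤ p i)
    (hv : ∀ i, ρ (v i) = (p i : ℂ) • v i) (F : Finset (Fin V → ℕ)) :
    ((∑ k ∈ F, ∑' i, entropyTerm v p (refWeight β μ lam) i k
        + (V * Real.log (sitePartition β μ lam) * (1 - ∑ k ∈ F, (⟪ket k, ρ (ket k)⟫_ℂ).re)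
        - (∑' k : Fin V → ℕ, Real.exp (-energy β μ lam k)
          - ∑ k ∈ F, Real.exp (-energy β μ lam k))) : ℝ) : EReal)
      ≤ (⨆ A : {A : Op V // IsSelfAdjoint A}, variationalValue β μ lam φ A)
        + ((V * Real.log (sitePartition β μ lam) : ℝ) : EReal) := by
  obtain ⟨n, hn⟩ := exists_le_variationalValue hβ hlam hρ hp0 hv F
  refine coe_le_of_forall_sub_mul_le (c := n) fun δ hδ => ?_
  obtain ⟨A, hA, hle⟩ := hn δ hδ
  have h1 := add_le_add_left (hle.trans
    (le_iSup (fun A : {A : Op V // IsSelfAdjoint A} => variationalValue β μ lam φ A) ⟨A, hA⟩))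
    ((V * Real.log (sitePartition β μ lam) : ℝ) : EReal)
  refine le_trans (le_of_eq ?_) h1
  rw [← EReal.coe_add]
  congr 1
  ring

/-- As `F` exhausts the kets, the missing mass of `ρ` and the tail of the partition function vanish.
The limit is taken in `EReal`, so infinite entropy needs no separate case. -/
lemma relativeEntropy_le_iSup (hβ : 0 < β) (hlam : 0 < lam ∨ (lam = 0 ∧ μ < 1))
    (hρ : IsDensityMatrixOf ρ φ) (hp0 : ∀ i, 0 ≤ p i)
    (hv : ∀ i, ρ (v i) = (p i : ℂ) • v i) :
    relativeEntropy ρ (refDensity V β μ lam)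
      ≤ (⨆ A : {A : Op V // IsSelfAdjoint A}, variationalValue β μ lam φ A)
        + ((V * Real.log (sitePartition β μ lam) : ℝ) : EReal) := by
  have hI2 := tsum_ofReal_neg_entropyTerm_ne_top v hp0 (refWeight_pos (V := V) hβ hlam)
    (summable_refWeight (μ := μ) hβ hlam)
  rw [relativeEntropy_eq v hρ.1.isSelfAdjoint (refDensity_isSelfAdjoint hβ hlam) hp0 hv
    (refDensity_ket hβ hlam) (refWeight_pos hβ hlam)]
  rw [ENNReal.tsum_comm] at hI2 ⊢
  rw [ENNReal.tsum_comm (f := fun i k => ENNReal.ofReal (-entropyTerm v p _ i k))]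
  set I₁ : (Fin V → ℕ) → ℝ≥0∞ := fun k =>
    ∑' i, ENNReal.ofReal (entropyTerm v p (refWeight β μ lam) i k) with hI₁
  set I₂ : (Fin V → ℕ) → ℝ≥0∞ := fun k =>
    ∑' i, ENNReal.ofReal (-entropyTerm v p (refWeight β μ lam) i k) with hI₂
  have hs := fun k => (hasSum_entropyTerm hβ hlam hρ hp0 hv k).summable
  have hI₁k : ∀ k, I₁ k ≠ ∞ := fun k => (hs k).tsum_ofReal_ne_top
  have hI₂k : ∀ k, I₂ k ≠ ∞ := fun k => (hs k).neg.tsum_ofReal_ne_top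
  have hlim1 : Filter.Tendsto (fun F => ((∑ k ∈ F, I₁ k : ℝ≥0∞) : EReal)) Filter.atTop
      (nhds ((∑' k, I₁ k : ℝ≥0∞) : EReal)) :=
    (continuous_coe_ennreal_ereal.tendsto _).comp ENNReal.summable.hasSum
  have hlim2 : Filter.Tendsto (fun F => -((∑ k ∈ F, I₂ k : ℝ≥0∞) : EReal)) Filter.atTop
      (nhds (-((∑' k, I₂ k : ℝ≥0∞) : EReal))) :=
    (continuous_neg.tendsto _).comp
      ((continuous_coe_ennreal_ereal.tendsto _).comp ENNReal.summable.hasSum)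
  have hne : ((∑' k, I₂ k : ℝ≥0∞) : EReal) ≠ ⊤ := by
    rwa [Ne, EReal.coe_ennreal_eq_top_iff]
  have hlim12 : Filter.Tendsto
      (fun F => ((∑ k ∈ F, I₁ k : ℝ≥0∞) : EReal) + -((∑ k ∈ F, I₂ k : ℝ≥0∞) : EReal)) Filter.atTop
      (nhds (((∑' k, I₁ k : ℝ≥0∞) : EReal) + -((∑' k, I₂ k : ℝ≥0∞) : EReal))) :=
    (EReal.continuousAt_add (p := (_, _)) (Or.inr (by simpa [EReal.neg_eq_bot_iff] using hne))
      (Or.inl (EReal.coe_ennreal_ne_bot _))).tendsto.comp (hlim1.prodMk_nhds hlim2)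
  have htr : HasSum (fun k => (⟪ket k, ρ (ket k)⟫_ℂ).re) 1 := by
    have h := ENNReal.hasSum_toReal (hρ.2.1.trans_ne ENNReal.one_ne_top)
    rw [← ENNReal.tsum_toReal_eq (fun k => ENNReal.ofReal_ne_top)] at h
    have h1 : (∑' k : Fin V → ℕ, ENNReal.ofReal (⟪ket k, ρ (ket k)⟫_ℂ).re) = 1 := hρ.2.1
    rw [h1, ENNReal.toReal_one] at h
    exact h.congr_fun fun k =>
      (ENNReal.toReal_ofReal (hρ.1.re_inner_nonneg_right (ket k))).symm
  have herr : Filter.Tendsto (fun F : Finset (Fin V → ℕ) =>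
      ((V * Real.log (sitePartition β μ lam) * (1 - ∑ k ∈ F, (⟪ket k, ρ (ket k)⟫_ℂ).re)
        - (∑' k : Fin V → ℕ, Real.exp (-energy β μ lam k)
          - ∑ k ∈ F, Real.exp (-energy β μ lam k)) : ℝ) : EReal)) Filter.atTop
      (nhds 0) := by
    rw [← EReal.coe_zero]
    refine (continuous_coe_real_ereal.tendsto 0).comp ?_
    have h := ((htr.const_sub 1).const_mul (V * Real.log (sitePartition β μ lam))).sub
      ((summable_exp_neg_energy (V := V) (μ := μ) hβ hlam).hasSum.const_sub
        (∑' k : Fin V → ℕ, Real.exp (-energy β μ lam k)))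
    simpa using h
  have hlim := (EReal.continuousAt_add (p := (_, 0)) (Or.inr EReal.zero_ne_bot)
    (Or.inr EReal.zero_ne_top)).tendsto.comp (hlim12.prodMk_nhds herr)
  simp only [add_zero, ← sub_eq_add_neg] at hlim
  refine le_of_tendsto' hlim fun F => ?_
  refine le_trans (le_of_eq ?_) (sum_entropyTerm_le_iSup hβ hlam hρ hp0 hv F)
  have e1 : ∀ I : (Fin V → ℕ) → ℝ≥0∞, (∀ k, I k ≠ ∞) →
      ((∑ k ∈ F, I k : ℝ≥0∞) : EReal) = ((∑ k ∈ F, (I k).toReal : ℝ) : EReal) := fun I hI => by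
    rw [← ENNReal.toReal_sum fun k _ => hI k]
    exact (EReal.coe_ennreal_toReal (ENNReal.sum_ne_top.mpr fun k _ => hI k)).symm
  simp only [Function.comp_apply]
  rw [e1 I₁ hI₁k, e1 I₂ hI₂k, ← EReal.coe_sub, ← EReal.coe_add]
  congr 2
  rw [← Finset.sum_sub_distrib]
  exact Finset.sum_congr rfl fun k _ =>
    (hasSum_of_tsum_ofReal_ne_top (hI₁k k) (hI₂k k)).tsum_eq.symm

lemma variationalValue_le_relativeEntropy (hβ : 0 < β) (hlam : 0 < lam ∨ (lam = 0 ∧ μ < 1))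
    (hρ : IsDensityMatrixOf ρ φ) (hp0 : ∀ i, 0 ≤ p i)
    (hv : ∀ i, ρ (v i) = (p i : ℂ) • v i) {A : Op V} (hA : IsSelfAdjoint A) :
    variationalValue β μ lam φ A
      ≤ relativeEntropy ρ (refDensity V β μ lam)
        - ((V * Real.log (sitePartition β μ lam) : ℝ) : EReal) := by
  have h2 := tsum_ofReal_neg_entropyTerm_ne_top v hp0 (refWeight_pos (V := V) hβ hlam)
    (summable_refWeight (μ := μ) hβ hlam)
  rw [relativeEntropy_eq v hρ.1.isSelfAdjoint (refDensity_isSelfAdjoint hβ hlam) hp0 hv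
    (refDensity_ket hβ hlam) (refWeight_pos hβ hlam)]
  -- Finiteness of the trace is not needed: an infinite one makes the functional `⊥`.
  by_cases hT : opTrace (opExp (gibbsExponent β μ lam A)) = ∞
  · rw [variationalValue, hT, ENNReal.log_top, sub_eq_add_neg, EReal.neg_top, EReal.add_bot]
    exact bot_le
  have hTpos := ENNReal.toReal_pos (opTrace_opExp_gibbsExponent_ne_zero hβ hlam hA) hT
  rw [variationalValue_eq hTpos (ENNReal.ofReal_toReal hT).symm]
  rw [← EReal.coe_ennreal_toReal h2]
  by_cases h1 : ∑' i, ∑' k, ENNReal.ofReal (entropyTerm v p (refWeight β μ lam) i k) = ∞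
  · rw [h1, EReal.coe_ennreal_top, EReal.top_sub_coe, EReal.top_sub_coe]
    exact le_top
  · rw [← EReal.coe_ennreal_toReal h1, ← EReal.coe_sub, ← EReal.coe_sub, EReal.coe_le_coe_iff]
    have := gibbs_variational_le hβ hlam hρ hp0 hv h1 h2 hA hT
    linarith

end VariationalPrinciple

end BoseEntropy

end

open BoseEntropy in
theorem mainTheorem1 (V : ℕ) (β μ lam : ℝ) (hβ : 0 < β)
    (hlam : 0 < lam ∨ (lam = 0 ∧ μ < 1))
    (φ : Op V →ₗ[ℂ] ℂ) (ρ : Op V) (hρ : IsDensityMatrixOf ρ φ) :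
    relativeEntropy ρ (refDensity V β μ lam)
      = (⨆ A : {A : Op V // IsSelfAdjoint A},
          (((β * (φ A).re : ℝ) : EReal)
            - ENNReal.log (opTrace (opExp (gibbsExponent β μ lam (A : Op V))))))
        + (V : EReal) * ENNReal.log (opTrace (opExp (gibbsExponent (V := 1) β μ lam 0))) := by
  obtain ⟨ι, v, p, hp0, hv⟩ := exists_hilbertBasis_eigenvectors hρ.1
    (isCompactOperator_of_opTrace_ne_top hρ.1 (hρ.2.1.trans_ne ENNReal.one_ne_top))
  rw [coe_mul_log_opTrace hβ hlam]
  refine le_antisymm (relativeEntropy_le_iSup hβ hlam hρ hp0 hv) (EReal.add_le_of_le_sub ?_)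
  exact iSup_le fun A => variationalValue_le_relativeEntropy hβ hlam hρ hp0 hv A.2
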